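/- **Setting.** Let $H\in\mathbb N$ be a horizon, write $[H]=\{0,\dots,H\}$, $]H]=\{1,\dots,H\}$, $[H[=\{0,\dots,H-1\}$. Let $\mathsf S$ be a separable metric space with a $\sigma$-algebra containing the open sets, and let $\mathsf A\neq\emptyset$ be a totally bounded metric space which also carries a $\sigma$-algebra. Consider a Markov decision process with transition kernels $P_h(\cdot|x,a)$, $h\in\,]H]$, from $\mathsf S\times\mathsf A$ to $\mathsf S$, measurable rewards $R_h:\mathsf S\times\mathsf A\to\mathbb R$, $h\in[H[$, and measurable terminal reward $F:\mathsf S\to\mathbb R$. For a policy $\boldsymbol\pi=(\pi_t)$ of Markov kernels $\pi_t$ from $\mathsf S$ to $\mathsf A$, let $A_t\sim\pi_t(S_t)$, $S_{t+1}\sim P_{t+1}(\cdot|S_t,A_t)$, and $$V_h^{\boldsymbol\pi}(x)=\mathbb E_{\boldsymbol\pi}\Big[\sum_{t=h}^{H-1}R_t(S_t,A_t)+F(S_H)\,\Big|\,S_h=x\Big],\qquad V_h^\star(x)=\sup_{\boldsymbol\pi}V_h^{\boldsymbol\pi}(x).$$ Write $P_h^aV(x)=\int V(y)\,P_h(dy|x,a)$.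 **Assumptions.** 1. There are a probability space $(\mathsf E,\mathcal P_{\mathsf E})$ and measurable maps $\mathcal K_h:\mathsf S\times\mathsf A\times\mathsf E\to\mathsf S$, $h\in\,]H]$, such that $P_h(\cdot|x,a)$ is the law of $\mathcal K_h(x,a,\varepsilon)$, $\varepsilon\sim\mathcal P_{\mathsf E}$, and for a norm $\|\cdot\|$ on $\mathbb R^2$ and a constant $L_{\mathcal K}\ge0$, $\rho(\mathcal K_h(x,a,\varepsilon),\mathcal K_h(x',a',\varepsilon))\le L_{\mathcal K}\|(\rho(x,x'),\rho(a,a'))\|$ for all $x,x',a,a',\varepsilon$. 2. $|R_h|\le R_{\max}$, $|F|\le R_{\max}$, and $\sup_a|R_h(x,a)-R_h(x',a)|\le L_R\,\rho(x,x')$ for $h\in[H[$, with $L_R\ge 0$. 3. $\mu_0,\dots,\mu_H$ are probability measures on $\mathsf S$ with $P_h(\cdot|x,a)\ll\mu_h$ for all $h\in\,]H]$, $x$, $a$, and $$\mathfrak R^{\max}:=\sup_{0\le h<l<H,\ \boldsymbol\pi}\Big(\int\mu_h(dx)\int\Big(\frac{P_{h+1}^{\pi_h}\cdots P_l^{\pi_{l-1}}(dx'|x)}{\mu_l(dx')}\Big)^2\mu_l(dx')\Big)^{1/2}<\infty,$$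 the supremum being over deterministic measurable policies, with $P_{t+1}^{\pi_t}(\cdot|x)=P_{t+1}(\cdot|x,\pi_t(x))$. (If $H\geq 2$ then $\mathfrak R^{\max}\ge1$; for $H\le 1$ we read $\mathfrak R^{\max}:=1$.) 4. $\boldsymbol\gamma_K=(\gamma_1,\dots,\gamma_K)^\top:\mathsf S\to\mathbb R^K$ satisfies $|\boldsymbol\gamma_K(x)-\boldsymbol\gamma_K(x')|\le L_{\gamma,K}\,\rho(x,x')$ with $L_{\gamma,K}\geq 0$, and for every $h\in[H[$: $\mathbb E_{X\sim\mu_h}|\boldsymbol\gamma_K(X)|^2\le\varrho_{\gamma,K}^2$ with $\varrho_{\gamma,K}\ge0$, the matrix $\Sigma_h=\mathbb E_{X\sim\mu_h}[\boldsymbol\gamma_K(X)\boldsymbol\gamma_K(X)^\top]$ is invertible, and $|\Sigma_h^{-1}\boldsymbol\gamma_K(x)|_\infty\le\Lambda_K$ for all $x\in\mathsf S$. 5. With $V^\star_{\max}:=(H+1)R_{\max}$ and $L_{V,K}:=L_R+V^\star_{\max}\Lambda_KL_{\gamma,K}\sqrt K$, the terminal reward satisfies $|F(x)-F(x')|\le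 L_{V,K}\,\rho(x,x')$ (in particular, this holds if $F$ is $L_R$-Lipschitz). **Algorithm.** Let $\widetilde L_h:=(H-h+1)R_{\max}$ and $\mathcal T_L[t]:=\max(-L,\min(L,t))$. Let $N\ge1$ and let $(X_i^h,\varepsilon_i^h)\sim\mu_h\otimes\mathcal P_{\mathsf E}$, $h\in[H[$, $1\le i\le N$, be independent, with joint law $\mathsf P$. Put $V_{H,N}=F$ and, for $h=H-1,\dots,0$, $$V_{h,N}(x)=\sup_{a\in\mathsf A}\big(R_h(x,a)+\mathcal T_{\widetilde L_{h+1}}[\beta_{N,a}^\top\boldsymbol\gamma_K(x)]\big),\qquad \beta_{N,a}=\frac1N\sum_{i=1}^NV_{h+1,N}\big(\mathcal K_{h+1}(X^h_i,a,\varepsilon^h_i)\big)\,\Sigma_h^{-1}\boldsymbol\gamma_K(X^h_i).$$ **Projection error.** For $\boldsymbol\zeta=(\zeta_a)_{a\in\mathsf A}$ with $\zeta_a\in\mathbb R^K$ let $V_{H,\boldsymbol\zeta}=F$, $V_{h,\boldsymbol\zeta}(x)=\sup_a(R_h(x,a)+\mathcal T_{\widetilde L_{h+1}}[\zeta_a^\top\boldsymbol\gamma_K(x)])$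 for $h\in[H[$, let $\beta_{a,\boldsymbol\zeta}$ minimize $\beta\mapsto\mathbb E_{X\sim\mu_h}[(\beta^\top\boldsymbol\gamma_K(X)-P_{h+1}^aV_{h+1,\boldsymbol\zeta}(X))^2]$ over $\mathbb{R}^K$, and $$\mathcal R_{K,h}:=\sup_{\boldsymbol\zeta}\ \mathbb E_{X\sim\mu_h}\Big[\sup_{a\in\mathsf A}\big(\beta_{a,\boldsymbol\zeta}^\top\boldsymbol\gamma_K(X)-P_{h+1}^aV_{h+1,\boldsymbol\zeta}(X)\big)^2\Big]^{1/2},$$ where the supremum over $a$ inside the expectation is the essential supremum of a family of random variables. **Theorem.** Let $\mathsf D(\mathsf A)$ be the diameter of $\mathsf A$ and $I_{\mathcal D}(\mathsf A)=\int_0^{\mathsf D(\mathsf A)}\sqrt{\log\mathcal N(\mathsf A,u)}\,du\in[0,\infty]$ its Dudley integral, $\mathcal N(\mathsf A,u)$ being the least number of balls of radius $u$ covering $\mathsf A$. There is an absolute constant $C>0$ such that, in every setting as above and for every $h\in[H]$, the function $V_h^\star-V_{h,N}$ is $\mu_h\otimes\mathsf P$-measurable and $$\|V_h^\star-V_{h,N}\|_{L^2(\mu_h\otimes\mathsf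 P)}\le C_\nu\,\mathfrak R^{\max}\Big((H-h)\,\varrho_{\gamma,K}\Lambda_K\big(L_{V,K}L_{\mathcal K}I_{\mathcal D}(\mathsf A)+L_{V,K}L_{\mathcal K}\mathsf D(\mathsf A)+V^\star_{\max}\big)\sqrt{\frac KN}+\sum_{l=h}^{H-1}\mathcal R_{K,l}\Big),$$ where $C_\nu=C\max(1,\|(0,1)\|)$ depends only on the norm on $\mathbb R^2$ fixed in assumption 1 (and $C_\nu=C$ if $\|(0,1)\|\le1$). Here $0\cdot\infty=0$. -/

import Mathlib

open MeasureTheory ProbabilityTheory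
open scoped ENNReal NNReal

universe u v w

/-! ## Markov decision processes and optimal values -/

/-- A finite-horizon Markov decision process with state space `S` and action space `A`.
The transition kernel `P h` matters for `1 ≤ h ≤ H` only, the reward `R h` for `h < H` only. -/
structure MDP (S : Type u) (A : Type v) [MeasurableSpace S] [MeasurableSpace A] where
  /-- horizon -/
  H : ℕ
  /-- transition kernels -/
  P : ℕ → Kernel (S × A) S
  markov_P : ∀ h, IsMarkovKernel (P h)
  /-- running rewards -/
  R : ℕ → S × A → ℝ
  measurable_R : ∀ h, Measurable (R h)
  /-- terminal reward -/
  F : S → ℝ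
  measurable_F : Measurable F

/-- A (randomized, Markov) policy: `kernel t x` is the law of the action taken at time `t` in
state `x`. -/
structure Policy (S : Type u) (A : Type v) [MeasurableSpace S] [MeasurableSpace A] where
  kernel : ℕ → Kernel S A
  markov : ∀ t, IsMarkovKernel (kernel t)

/-- A deterministic Markov policy. -/
structure DetPolicy (S : Type u) (A : Type v) [MeasurableSpace S] [MeasurableSpace A] where
  act : ℕ → S → A
  measurable_act : ∀ t, Measurable (act t)

namespace MDP

variable {S : Type u} {A : Type v} [MeasurableSpace S] [MeasurableSpace A]

/-- `M.pathLaw π n h x` is the joint law of `(S_h, A_h), …, (S_{h+n}, A_{h+n})` for the process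
controlled by `π` and started at `S_h = x`: here `A_t ∼ π_t(S_t)` and
`S_{t+1} ∼ P_{t+1}(· | S_t, A_t)`. -/
noncomputable def pathLaw (M : MDP S A) (π : Policy S A) :
    (n h : ℕ) → Kernel S (Fin (n + 1) → S × A)
  | 0, h => (Kernel.id ×ₖ π.kernel h).map (fun p _ => p)
  | n + 1, h =>
      ((Kernel.id ×ₖ π.kernel h) ⊗ₖ
          Kernel.prodMkLeft S (M.pathLaw π n (h + 1) ∘ₖ M.P (h + 1))).map
        (fun q => Fin.cons q.1 q.2)

/-- `V_h^π(x)`, the expectation of `∑_{t=h}^{H-1} R_t(S_t, A_t) + F(S_H)` given `S_h = x`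
(for `h ≤ H`). -/
noncomputable def value (M : MDP S A) (π : Policy S A) (h : ℕ) (x : S) : ℝ :=
  ∫ ω, ((∑ i : Fin (M.H - h), M.R (h + i) (ω i.castSucc)) + M.F (ω (Fin.last _)).1)
    ∂(M.pathLaw π (M.H - h) h x)

/-- The optimal value function `V_h^⋆(x) = sup_π V_h^π(x)`. -/
noncomputable def optValue (M : MDP S A) (h : ℕ) (x : S) : ℝ :=
  ⨆ π : Policy S A, M.value π h x

/-- `P_h^a V (x)`, the expectation of `V(S')` for `S' ∼ P_h(· | x, a)`. -/
noncomputable def trans (M : MDP S A) (h : ℕ) (a : A) (V : S → ℝ) (x : S) : ℝ :=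
  ∫ y, V y ∂(M.P h (x, a))

/-- The `n`-step transition kernel `P_{h+1}^{π_h} ⋯ P_{h+n}^{π_{h+n-1}}` of a deterministic
policy. -/
noncomputable def detKernel (M : MDP S A) (π : DetPolicy S A) (h : ℕ) : ℕ → Kernel S S
  | 0 => Kernel.id
  | n + 1 =>
      ((M.P (h + n + 1)).comap (fun x => (x, π.act (h + n) x))
          (measurable_id.prodMk (π.measurable_act (h + n)))) ∘ₖ M.detKernel π h n

/-- The supremum, over deterministic policies `π` and times `0 ≤ h < l < H`, of
`(∫ μ_h(dx) ∫ 𝔯_{h,l}(x' | x, π)² μ_l(dx'))^{1/2}`, where `𝔯_{h,l}(· | x, π)` is the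
Radon-Nikodym derivative of the `(l-h)`-step transition law from `x` with respect to `μ_l`. -/
noncomputable def changeOfMeasure (M : MDP S A) (μ : ℕ → Measure S) : ℝ≥0∞ :=
  ⨆ (π : DetPolicy S A) (h : ℕ) (l : ℕ) (_ : h < l) (_ : l < M.H),
    (∫⁻ x, ∫⁻ y, ((M.detKernel π h (l - h) x).rnDeriv (μ l) y) ^ 2 ∂(μ l) ∂(μ h)) ^ (1 / 2 : ℝ)

end MDP

/-! ## The backward pseudo-regression algorithm -/

/-- Truncation at level `L`. -/
noncomputable def clip (L t : ℝ) : ℝ := max (-L) (min L t)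

/-- The level `(H - h + 1) R_max`. -/
noncomputable def clipLevel (H : ℕ) (Rmax : ℝ) (h : ℕ) : ℝ := ((H : ℝ) - h + 1) * Rmax

section Regression

variable {S : Type u} {A : Type v} {E : Type w}
  [MeasurableSpace S] [MeasurableSpace A] [MeasurableSpace E]

/-- The matrix `𝔼_{X ∼ μ}[γ(X) γ(X)ᵀ]`. -/
noncomputable def gram {K : ℕ} (γ : S → EuclideanSpace ℝ (Fin K)) (μ : Measure S) :
    Matrix (Fin K) (Fin K) ℝ :=
  Matrix.of fun i j => ∫ x, γ x i * γ x j ∂μ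

/-- `βᵀ γ(x)`. -/
noncomputable def linComb {K : ℕ} (γ : S → EuclideanSpace ℝ (Fin K)) (β : Fin K → ℝ) (x : S) : ℝ :=
  ∑ k, β k * γ x k

/-- `Σ⁻¹ γ(x)` with `Σ = 𝔼_{X ∼ μ}[γ(X) γ(X)ᵀ]`. -/
noncomputable def dualBasis {K : ℕ} (γ : S → EuclideanSpace ℝ (Fin K)) (μ : Measure S) (x : S) :
    Fin K → ℝ :=
  Matrix.mulVec (gram γ μ)⁻¹ (fun k => γ x k)

/-- The pseudo-regression coefficients `β_{N,a} = N⁻¹ ∑_i V(Y_i^a) Σ⁻¹ γ(X_i)`, computed from a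
sample of pairs `(X_i, ε_i)`, with `Y_i^a = κ(X_i, a, ε_i)`. -/
noncomputable def betaHat {K N : ℕ} (γ : S → EuclideanSpace ℝ (Fin K)) (μ : Measure S)
    (κ : S × A × E → S) (V : S → ℝ) (sample : Fin N → S × E) (a : A) : Fin K → ℝ :=
  (N : ℝ)⁻¹ • ∑ i, V (κ ((sample i).1, a, (sample i).2)) • dualBasis γ μ (sample i).1

/-- The estimates `V_{h,N}`, as functions of the simulated data: `data t` consists of the pairs
`(X_i^t, ε_i^t)`, `i = 1, …, N`, used in the step from time `t + 1` to time `t`. -/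
noncomputable def valueEst {K N : ℕ} (M : MDP S A) (κ : ℕ → S × A × E → S) (μ : ℕ → Measure S)
    (γ : S → EuclideanSpace ℝ (Fin K)) (Rmax : ℝ) (data : Fin M.H → Fin N → S × E)
    (h : ℕ) (x : S) : ℝ :=
  if hh : h < M.H then
    ⨆ a : A, (M.R h (x, a) + clip (clipLevel M.H Rmax (h + 1))
      (linComb γ (betaHat γ (μ h) (κ (h + 1)) (valueEst M κ μ γ Rmax data (h + 1))
        (data ⟨h, hh⟩) a) x))
  else M.F x
termination_by M.H - h

/-- The law of the data: all pairs `(X_i^h, ε_i^h) ∼ μ_h ⊗ P_E` are independent. -/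
noncomputable def dataLaw (H N : ℕ) (μ : ℕ → Measure S) (PE : Measure E) :
    Measure (Fin H → Fin N → S × E) :=
  Measure.pi fun t : Fin H => Measure.pi fun _ : Fin N => (μ t).prod PE

/-! ## The projection error -/

/-- `V_{h,ζ}`, for a family of coefficient vectors `ζ_a`. -/
noncomputable def valueCoef {K : ℕ} (M : MDP S A) (γ : S → EuclideanSpace ℝ (Fin K)) (Rmax : ℝ)
    (ζ : A → Fin K → ℝ) (h : ℕ) (x : S) : ℝ :=
  if h < M.H then
    ⨆ a : A, (M.R h (x, a) + clip (clipLevel M.H Rmax (h + 1)) (linComb γ (ζ a) x))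
  else M.F x

/-- A minimizer over `β` of `𝔼_{X ∼ μ}[(βᵀ γ(X) - g(X))²]`. -/
noncomputable def regCoef {K : ℕ} (γ : S → EuclideanSpace ℝ (Fin K)) (μ : Measure S) (g : S → ℝ) :
    Fin K → ℝ :=
  Classical.epsilon fun β =>
    ∀ β' : Fin K → ℝ, ∫ x, (linComb γ β x - g x) ^ 2 ∂μ ≤ ∫ x, (linComb γ β' x - g x) ^ 2 ∂μ

/-- The expectation of the essential supremum of a family of nonnegative functions: the essential
supremum is the smallest measurable function which dominates each member of the family almost
everywhere. -/
noncomputable def expEssSup (μ : Measure S) (f : A → S → ℝ≥0∞) : ℝ≥0∞ :=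
  ⨅ (g : S → ℝ≥0∞) (_ : Measurable g) (_ : ∀ a, f a ≤ᵐ[μ] g), ∫⁻ x, g x ∂μ

/-- The worst-case projection error at time `h`,
`sup_ζ 𝔼_{X ∼ μ_h}[sup_a (β_{a,ζ}ᵀ γ(X) - P_{h+1}^a V_{h+1,ζ}(X))²]^{1/2}`. -/
noncomputable def projError {K : ℕ} (M : MDP S A) (μ : ℕ → Measure S)
    (γ : S → EuclideanSpace ℝ (Fin K)) (Rmax : ℝ) (h : ℕ) : ℝ≥0∞ :=
  ⨆ ζ : A → Fin K → ℝ,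
    (expEssSup (μ h) fun (a : A) (x : S) => ENNReal.ofReal
      ((linComb γ (regCoef γ (μ h) (M.trans (h + 1) a (valueCoef M γ Rmax ζ (h + 1)))) x
        - M.trans (h + 1) a (valueCoef M γ Rmax ζ (h + 1)) x) ^ 2)) ^ (1 / 2 : ℝ)

end Regression

/-! ## The Dudley integral -/

/-- `√(log n)`, with the value `∞` at `n = ∞`. -/
noncomputable def sqrtLog (n : ℕ∞) : ℝ≥0∞ :=
  if n = ⊤ then ⊤ else ENNReal.ofReal (Real.sqrt (Real.log (n.toNat : ℝ)))

/-- The Dudley integral `∫_0^{diam X} √(log 𝒩(X, u)) du`, where `𝒩(X, u)` is the smallest number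
of balls of radius `u` that cover `X`. -/
noncomputable def dudleyIntegral (X : Type v) [MetricSpace X] : ℝ≥0∞ :=
  ∫⁻ r in {r : ℝ | 0 < r ∧ ENNReal.ofReal r < Metric.ediam (Set.univ : Set X)},
    sqrtLog (Metric.coveringNumber r.toNNReal (Set.univ : Set X))

/-!
Write `d_h = |V_h^⋆ - V_{h,N}|`. The argument has a deterministic part, for fixed data, and a
probabilistic part.

*Lipschitz regularity replaces measurable selection.* The optimal values solve the Bellman
recursion (`MDP.LipschitzReward.optValue_eq_bellman`) because all functions to be maximized are
Lipschitz in the state, uniformly in the action; on a separable space nearly optimal actions can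
then be chosen constant on the pieces of a countable measurable partition
(`exists_measurable_nearly_optimal`). The estimates `V_{h,N}` are Lipschitz in the state, with a
constant that does not depend on the data, and this makes them jointly measurable
(`measurable_valueEst`).

*Fixed data.* Comparing the two recursions gives `d_h ≤ z_h + sup_a P_{h+1}^a d_{h+1}`, where
`z_h` is the error of the regression step (`stepError`). Choosing nearly optimal actions and
iterating, `d_h` is bounded by `∑_l P_{h+1}^{π_h} ⋯ P_l^{π_{l-1}} z_l` for one deterministic
policy `π`, up to an arbitrarily small error (`exists_policy_le_stepError`,
`MDP.le_sum_lintegral_detKernel`). By the Cauchy-Schwarz inequality for the Radon-Nikodym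
derivatives the change of measure coefficient bounds these kernels from `L²(μ_l)` to `L²(μ_h)`
(`MDP.l2Norm_lintegral_detKernel_le`). Finally `z_l` is at most the projection error plus `|γ|`
times the error of the coefficients (`l2Norm_stepError_le`).

*Random data.* The least squares coefficients are `𝔼[g(X) Σ⁻¹ γ(X)]` (`regCoef_apply`), so the
error of the pseudo-regression coefficients for a fixed function `V` is an empirical process
indexed by the actions. By Hoeffding's lemma its increments are subgaussian, and Dudley's chaining
bound (`l2Norm_iSup_le_dudleyIntegral`) controls its supremum in `L²`. The function `V_{l+1,N}`
depends only on the data from time `l + 1` on, so Tonelli's theorem for the data at time `l`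
reduces the general case to that of a fixed `V` (`l2Norm_coefError_le`).
-/


/-! ### The `L²` norm of extended nonnegative functions -/

/-- The `L²(μ)` norm of a function with values in `[0, ∞]`. -/
noncomputable def l2Norm {Ω : Type*} [MeasurableSpace Ω] (μ : Measure Ω) (f : Ω → ℝ≥0∞) : ℝ≥0∞ :=
  (∫⁻ x, f x ^ 2 ∂μ) ^ (1 / 2 : ℝ)

section L2Norm

variable {Ω : Type*} [MeasurableSpace Ω] {μ : Measure Ω}

lemma l2Norm_mono_ae {f g : Ω → ℝ≥0∞} (h : ∀ᵐ x ∂μ, f x ≤ g x) : l2Norm μ f ≤ l2Norm μ g := by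
  unfold l2Norm
  gcongr ?_ ^ _
  exact lintegral_mono_ae (h.mono fun x hx => by gcongr)

lemma l2Norm_mono {f g : Ω → ℝ≥0∞} (h : ∀ x, f x ≤ g x) : l2Norm μ f ≤ l2Norm μ g :=
  l2Norm_mono_ae (ae_of_all _ h)

lemma sq_l2Norm (f : Ω → ℝ≥0∞) : l2Norm μ f ^ 2 = ∫⁻ x, f x ^ 2 ∂μ := by
  rw [l2Norm, ← ENNReal.rpow_natCast, ← ENNReal.rpow_mul]
  norm_num

lemma l2Norm_le_iff {f : Ω → ℝ≥0∞} {c : ℝ≥0∞} : l2Norm μ f ≤ c ↔ ∫⁻ x, f x ^ 2 ∂μ ≤ c ^ 2 := by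
  rw [← sq_l2Norm]
  exact (ENNReal.pow_le_pow_left_iff two_ne_zero).symm

lemma l2Norm_add_le {f g : Ω → ℝ≥0∞} (hf : AEMeasurable f μ) (hg : AEMeasurable g μ) :
    l2Norm μ (fun x => f x + g x) ≤ l2Norm μ f + l2Norm μ g := by
  have := ENNReal.lintegral_Lp_add_le hf hg (p := 2) (by norm_num)
  simpa [l2Norm] using this

lemma l2Norm_sum_le {ι : Type*} (s : Finset ι) {f : ι → Ω → ℝ≥0∞}
    (hf : ∀ i ∈ s, AEMeasurable (f i) μ) :
    l2Norm μ (fun x => ∑ i ∈ s, f i x) ≤ ∑ i ∈ s, l2Norm μ (f i) := by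
  classical
  induction s using Finset.induction_on with
  | empty => simp [l2Norm]
  | insert a s ha ih =>
    simp only [Finset.sum_insert ha]
    refine (l2Norm_add_le (hf a (by simp)) ?_).trans ?_
    · exact Finset.aemeasurable_fun_sum s fun i hi => hf i (by simp [hi])
    · gcongr
      exact ih fun i hi => hf i (by simp [hi])

lemma l2Norm_const [IsProbabilityMeasure μ] (c : ℝ≥0∞) : l2Norm μ (fun _ => c) = c := by
  rw [l2Norm, lintegral_const, measure_univ, mul_one, ← ENNReal.rpow_natCast, ← ENNReal.rpow_mul]
  norm_num

lemma l2Norm_const_mul {f : Ω → ℝ≥0∞} (c : ℝ≥0∞) (hf : AEMeasurable f μ) :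
    l2Norm μ (fun x => c * f x) = c * l2Norm μ f := by
  unfold l2Norm
  simp only [mul_pow]
  rw [lintegral_const_mul'' _ (hf.pow_const 2), ENNReal.mul_rpow_of_nonneg _ _ (by norm_num),
    ← ENNReal.rpow_natCast, ← ENNReal.rpow_mul]
  norm_num

end L2Norm

/-! ### Maxima of subgaussian variables and Dudley's bound -/

/-- The quadratic-by-exponential bound that lets moment generating functions control second
moments without integrating tails. -/
lemma sq_le_sq_add_exp {L u : ℝ} (hL : 1 ≤ L) (hu : 0 ≤ u) :
    u ^ 2 ≤ L ^ 2 + 2 * L * Real.exp (u - L) := by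
  rcases le_total u L with h | h
  · have := Real.exp_pos (u - L)
    nlinarith [mul_pos (by linarith : (0:ℝ) < L) this]
  · have := Real.quadratic_le_exp_of_nonneg (x := u - L) (by linarith)
    nlinarith [sq_nonneg (u - L)]

section Maxima

variable {Ω : Type*} [MeasurableSpace Ω] {P : Measure Ω} [IsProbabilityMeasure P]

/-- The second moment of a maximum of `n` subgaussian variables is at most
`σ² (2 log n + 4)`. -/
lemma lintegral_iSup_sq_le_of_hasSubgaussianMGF {ι : Type*} [Fintype ι] [Nonempty ι]
    {W : ι → Ω → ℝ} {σ : ℝ≥0} (h : ∀ j, HasSubgaussianMGF (W j) (σ ^ 2) P) :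
    ∫⁻ ω, (⨆ j, ‖W j ω‖ₑ) ^ 2 ∂P ≤
      ENNReal.ofReal (σ ^ 2 * (2 * Real.log (Fintype.card ι) + 4)) := by
  have hcard : (1 : ℝ) ≤ Fintype.card ι := by exact_mod_cast Fintype.card_pos
  have hlog : 0 ≤ Real.log (Fintype.card ι) := Real.log_nonneg hcard
  rcases eq_or_ne σ 0 with rfl | hσ
  · have h0 : ∀ᵐ ω ∂P, ∀ j, W j ω = 0 := by
      rw [ae_all_iff]
      intro j
      have := h j
      simp only [ne_eq, OfNat.ofNat_ne_zero, not_false_eq_true, zero_pow] at this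
      exact this.ae_eq_zero_of_hasSubgaussianMGF_zero
    rw [lintegral_congr_ae (g := fun _ => 0) (h0.mono fun ω hω => by simp [hω])]
    simp
  have hσ0 : (0 : ℝ) < σ := by positivity
  -- the choice of `L` makes the union bound over `n` variables cost a constant
  set L : ℝ := 2 * (1 + Real.log (Fintype.card ι)) with hLdef
  have hL : 2 ≤ L := by rw [hLdef]; linarith
  set t : ℝ := Real.sqrt L / σ with htdef
  have ht : 0 < t := by positivity
  have ht2 : (σ : ℝ) ^ 2 * t ^ 2 = L := by
    rw [htdef, div_pow, Real.sq_sqrt (by linarith)]; field_simp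
  let g : Ω → ℝ := fun ω => L ^ 2 + 2 * L * Real.exp (-L) *
    ∑ j, (Real.exp (t * W j ω) + Real.exp (-t * W j ω))
  have hgint : Integrable g P := by
    refine (integrable_const _).add (Integrable.const_mul ?_ _)
    exact integrable_finsetSum _ fun j _ =>
      ((h j).integrable_exp_mul t).add ((h j).integrable_exp_mul (-t))
  have hg0 : ∀ ω, 0 ≤ g ω := fun ω => by
    have : 0 ≤ ∑ j, (Real.exp (t * W j ω) + Real.exp (-t * W j ω)) :=
      Finset.sum_nonneg fun j _ => by positivity
    have := Real.exp_pos (-L)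
    simp only [g]; positivity
  have hpt : ∀ ω j, (t * |W j ω|) ^ 2 ≤ g ω := by
    intro ω j
    refine (sq_le_sq_add_exp (L := L) (by linarith) (by positivity)).trans ?_
    have h1 : Real.exp (t * |W j ω|) ≤ Real.exp (t * W j ω) + Real.exp (-t * W j ω) := by
      rcases abs_cases (W j ω) with ⟨h1, -⟩ | ⟨h1, -⟩ <;> rw [h1]
      · have := Real.exp_pos (-t * W j ω); linarith
      · have := Real.exp_pos (t * W j ω)
        rw [show t * -W j ω = -t * W j ω by ring]; linarith
    have h2 : Real.exp (t * W j ω) + Real.exp (-t * W j ω) ≤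
        ∑ j, (Real.exp (t * W j ω) + Real.exp (-t * W j ω)) :=
      Finset.single_le_sum (f := fun j => Real.exp (t * W j ω) + Real.exp (-t * W j ω))
        (fun j _ => by positivity) (Finset.mem_univ j)
    simp only [g]
    rw [sub_eq_neg_add, Real.exp_add, ← mul_assoc]
    gcongr
    exact h1.trans h2
  have hgI : ∫ ω, g ω ∂P ≤ L ^ 2 + 2 * L := by
    have hS : ∫ ω, ∑ j, (Real.exp (t * W j ω) + Real.exp (-t * W j ω)) ∂P ≤
        Fintype.card ι * (2 * Real.exp (L / 2)) := by
      rw [integral_finsetSum]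
      swap
      · exact fun j _ => ((h j).integrable_exp_mul t).add ((h j).integrable_exp_mul (-t))
      calc _ ≤ ∑ j : ι, 2 * Real.exp (L / 2) := by
            refine Finset.sum_le_sum fun j _ => ?_
            rw [integral_add ((h j).integrable_exp_mul t) ((h j).integrable_exp_mul (-t))]
            have h1 := (h j).mgf_le t
            have h2 := (h j).mgf_le (-t)
            rw [mgf] at h1 h2
            rw [neg_sq] at h2
            push_cast at h1 h2
            rw [ht2] at h1 h2
            linarith
        _ = _ := by simp
    have hI : Integrable (fun ω => ∑ j, (Real.exp (t * W j ω) + Real.exp (-t * W j ω))) P :=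
      integrable_finsetSum _ fun j _ =>
        ((h j).integrable_exp_mul t).add ((h j).integrable_exp_mul (-t))
    have : ∫ ω, g ω ∂P = L ^ 2 + 2 * L * Real.exp (-L) *
        ∫ ω, ∑ j, (Real.exp (t * W j ω) + Real.exp (-t * W j ω)) ∂P := by
      simp only [g]
      rw [integral_add (integrable_const _) (hI.const_mul _), integral_const_mul]
      simp
    rw [this]
    have hexp : Real.exp (-L) * (Fintype.card ι * (2 * Real.exp (L / 2))) ≤ 1 := by
      have e1 : (Fintype.card ι : ℝ) = Real.exp (Real.log (Fintype.card ι)) :=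
        (Real.exp_log (by linarith)).symm
      rw [e1, show Real.exp (-L) * (Real.exp (Real.log (Fintype.card ι)) * (2 * Real.exp (L / 2)))
        = 2 * (Real.exp (-L) * Real.exp (Real.log (Fintype.card ι)) * Real.exp (L / 2)) by ring,
        ← Real.exp_add, ← Real.exp_add,
        show -L + Real.log (Fintype.card ι) + L / 2 = -1 by rw [hLdef]; ring, Real.exp_neg]
      have := Real.add_one_le_exp (1 : ℝ)
      rw [← div_eq_mul_inv, div_le_one (Real.exp_pos 1)]
      linarith
    have hle : Real.exp (-L) * ∫ ω, ∑ j, (Real.exp (t * W j ω) + Real.exp (-t * W j ω)) ∂P ≤ 1 :=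
      le_trans (by gcongr) hexp
    nlinarith
  calc ∫⁻ ω, (⨆ j, ‖W j ω‖ₑ) ^ 2 ∂P ≤ ∫⁻ ω, ENNReal.ofReal (g ω / t ^ 2) ∂P := by
        refine lintegral_mono fun ω => ?_
        obtain ⟨j, hj⟩ := exists_eq_ciSup_of_finite (f := fun j => ‖W j ω‖ₑ)
        rw [← hj, Real.enorm_eq_ofReal_abs, ← ENNReal.ofReal_pow (abs_nonneg _)]
        refine ENNReal.ofReal_le_ofReal ?_
        rw [le_div_iff₀ (by positivity)]
        calc _ = (t * |W j ω|) ^ 2 := by ring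
          _ ≤ g ω := hpt ω j
    _ = ENNReal.ofReal (∫ ω, g ω / t ^ 2 ∂P) :=
        (ofReal_integral_eq_lintegral_ofReal (hgint.div_const _)
          (ae_of_all _ fun ω => div_nonneg (hg0 ω) (by positivity))).symm
    _ ≤ _ := by
        refine ENNReal.ofReal_le_ofReal ?_
        rw [integral_div, div_le_iff₀ (by positivity)]
        calc _ ≤ L ^ 2 + 2 * L := hgI
          _ = (σ ^ 2 * t ^ 2) * (L + 2) := by rw [ht2]; ring
          _ = _ := by rw [hLdef]; ring

lemma l2Norm_iSup_le_of_hasSubgaussianMGF {ι : Type*} [Fintype ι] [Nonempty ι]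
    {W : ι → Ω → ℝ} {σ : ℝ≥0} (h : ∀ j, HasSubgaussianMGF (W j) (σ ^ 2) P) :
    l2Norm P (fun ω => ⨆ j, ‖W j ω‖ₑ) ≤
      ENNReal.ofReal (σ * (Real.sqrt 2 * Real.sqrt (Real.log (Fintype.card ι)) + 2)) := by
  have hcard : (1 : ℝ) ≤ Fintype.card ι := by exact_mod_cast Fintype.card_pos
  have hlog : 0 ≤ Real.log (Fintype.card ι) := Real.log_nonneg hcard
  rw [l2Norm_le_iff]
  refine (lintegral_iSup_sq_le_of_hasSubgaussianMGF h).trans ?_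
  rw [← ENNReal.ofReal_pow (by positivity)]
  refine ENNReal.ofReal_le_ofReal ?_
  rw [mul_pow]
  gcongr
  have h1 := Real.sq_sqrt hlog
  have h2 := Real.sq_sqrt (show (0:ℝ) ≤ 2 by norm_num)
  have : 0 ≤ Real.sqrt 2 * Real.sqrt (Real.log (Fintype.card ι)) := by positivity
  calc _ = (Real.sqrt 2) ^ 2 * (Real.sqrt (Real.log (Fintype.card ι))) ^ 2 + 4 := by rw [h1, h2]
    _ ≤ _ := by nlinarith

end Maxima

lemma ProbabilityTheory.HasSubgaussianMGF.mono {Ω : Type*} [MeasurableSpace Ω] {P : Measure Ω}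
    {X : Ω → ℝ} {c d : ℝ≥0} (h : HasSubgaussianMGF X c P) (hcd : c ≤ d) :
    HasSubgaussianMGF X d P where
  integrable_exp_mul := h.integrable_exp_mul
  mgf_le t := (h.mgf_le t).trans (by gcongr)

lemma sqrtLog_mono {m n : ℕ∞} (h : m ≤ n) : sqrtLog m ≤ sqrtLog n := by
  unfold sqrtLog
  by_cases hn : n = ⊤
  · simp [hn]
  have hm : m ≠ ⊤ := ne_top_of_le_ne_top hn h
  rw [if_neg hn, if_neg hm]
  have h' : m.toNat ≤ n.toNat := ENat.toNat_le_toNat h hn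
  rcases Nat.eq_zero_or_pos m.toNat with h0 | h0
  · simp [h0]
  · gcongr

section Dudley

variable {A : Type*} [MetricSpace A]

lemma coveringNumber_univ_ne_top (hA : TotallyBounded (Set.univ : Set A)) {r : ℝ≥0} (hr : r ≠ 0) :
    Metric.coveringNumber r (Set.univ : Set A) ≠ ⊤ := by
  obtain ⟨N, hN, hfin, hcov⟩ := Metric.exists_finite_isCover_of_totallyBounded hr hA
  exact ne_top_of_le_ne_top (Set.encard_ne_top_iff.2 hfin) (hcov.coveringNumber_le_encard hN)

/-- The discretized entropy sum is bounded by the Dudley integral: since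
`r_k = 4 (r_{k+1} - r_{k+2})` for dyadic scales, each term is an integral over its own
interval. -/
lemma sum_dyadic_sqrtLog_le_dudleyIntegral (D : ℝ≥0) (hD : ↑D = Metric.ediam (Set.univ : Set A))
    (m : ℕ) :
    ∑ k ∈ Finset.range m, ENNReal.ofReal ((D : ℝ) / 2 ^ k) *
      sqrtLog (Metric.coveringNumber (D / 2 ^ (k + 1)) (Set.univ : Set A)) ≤
    4 * dudleyIntegral A := by
  let r : ℕ → ℝ := fun k => (D : ℝ) / 2 ^ k
  have hr0 : ∀ k, 0 ≤ r k := fun k => by positivity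
  have hr : Antitone r := antitone_nat_of_succ_le fun k => by
    have : r (k + 1) = r k / 2 := by simp only [r]; rw [pow_succ]; field_simp
    have := hr0 k
    linarith
  have hterm : ∀ k, ENNReal.ofReal ((D : ℝ) / 2 ^ k) *
      sqrtLog (Metric.coveringNumber (D / 2 ^ (k + 1)) (Set.univ : Set A)) ≤
      4 * ∫⁻ u in Set.Ioo (r (k + 1 + 1)) (r (k + 1)),
        sqrtLog (Metric.coveringNumber u.toNNReal (Set.univ : Set A)) := by
    intro k
    have h1 : ∫⁻ _ in Set.Ioo (r (k + 1 + 1)) (r (k + 1)),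
        sqrtLog (Metric.coveringNumber (D / 2 ^ (k + 1)) (Set.univ : Set A)) ≤
        ∫⁻ u in Set.Ioo (r (k + 1 + 1)) (r (k + 1)),
        sqrtLog (Metric.coveringNumber u.toNNReal (Set.univ : Set A)) := by
      refine setLIntegral_mono' measurableSet_Ioo fun u hu => sqrtLog_mono ?_
      refine Metric.coveringNumber_anti ?_
      rw [← NNReal.coe_le_coe, Real.coe_toNNReal _ ((hr0 _).trans hu.1.le)]
      push_cast
      exact hu.2.le
    refine le_trans (le_of_eq ?_) (mul_le_mul_right h1 4)
    rw [setLIntegral_const, Real.volume_Ioo, mul_comm (sqrtLog _), ← mul_assoc]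
    congr 1
    rw [show (4 : ℝ≥0∞) = ENNReal.ofReal 4 by simp, ← ENNReal.ofReal_mul (by norm_num)]
    congr 1
    simp only [r]
    rw [pow_succ, pow_succ]
    field_simp
    ring
  calc _ ≤ ∑ k ∈ Finset.range m, 4 * ∫⁻ u in Set.Ioo (r (k + 1 + 1)) (r (k + 1)),
        sqrtLog (Metric.coveringNumber u.toNNReal (Set.univ : Set A)) :=
        Finset.sum_le_sum fun k _ => hterm k
    _ = 4 * ∫⁻ u in ⋃ k ∈ Finset.range m, Set.Ioo (r (k + 1 + 1)) (r (k + 1)),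
        sqrtLog (Metric.coveringNumber u.toNNReal (Set.univ : Set A)) := by
        rw [← Finset.mul_sum, lintegral_biUnion_finset]
        · intro i _ j _ hij
          exact (hr.comp_monotone (fun a b h => Nat.succ_le_succ h) :
            Antitone fun k => r (k + 1)).pairwise_disjoint_on_Ioo_succ hij
        · exact fun k _ => measurableSet_Ioo
    _ ≤ _ := by
        unfold dudleyIntegral
        gcongr
        intro u hu
        simp only [Set.mem_iUnion] at hu
        obtain ⟨k, -, hu⟩ := hu
        have hu0 : 0 < u := (hr0 _).trans_lt hu.1
        refine ⟨hu0, ?_⟩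
        rw [← hD, ENNReal.ofReal_lt_coe_iff hu0.le]
        calc u < r (k + 1) := hu.2
          _ ≤ r 0 := hr (Nat.zero_le _)
          _ = D := by simp [r]

variable {Ω : Type*} [MeasurableSpace Ω] {P : Measure Ω} [IsProbabilityMeasure P]

/-- Dudley's entropy bound in `L²`, by chaining along minimal covers at the dyadic scales
`diam A / 2 ^ k`. The pathwise Lipschitz bound `M`, which does not enter the conclusion, makes
the chains converge to the supremum over all of `A`. -/
lemma l2Norm_iSup_le_dudleyIntegral [Nonempty A] (hA : TotallyBounded (Set.univ : Set A))
    {G : A → Ω → ℝ} (hmeas : ∀ a, Measurable (G a)) {b c : ℝ≥0}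
    (hb : ∀ a, HasSubgaussianMGF (G a) (b ^ 2) P)
    (hc : ∀ a a', HasSubgaussianMGF (fun ω => G a ω - G a' ω) ((c * nndist a a') ^ 2) P)
    {M : ℝ≥0} (hM : ∀ ω a a', ‖G a ω - G a' ω‖ₑ ≤ M * edist a a') :
    l2Norm P (fun ω => ⨆ a, ‖G a ω‖ₑ) ≤
      c * (6 * dudleyIntegral A + 4 * Metric.ediam (Set.univ : Set A)) + 2 * b := by
  have hone : ∀ (ι : Type _) [Fintype ι] [Nonempty ι] [Subsingleton ι] (f : ι → A),
      l2Norm P (fun ω => ⨆ i, ‖G (f i) ω‖ₑ) ≤ 2 * b := by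
    intro ι _ _ _ f
    refine (l2Norm_iSup_le_of_hasSubgaussianMGF (fun i => hb (f i))).trans (le_of_eq ?_)
    have : Fintype.card ι = 1 := le_antisymm
      (Fintype.card_le_one_iff_subsingleton.2 inferInstance) Fintype.card_pos
    rw [this]
    simp [mul_comm]
  obtain ⟨D, hD⟩ : ∃ D : ℝ≥0, ↑D = Metric.ediam (Set.univ : Set A) :=
    ⟨_, ENNReal.coe_toNNReal (Metric.isBounded_iff_ediam_ne_top.1 hA.isBounded)⟩
  rcases eq_or_ne D 0 with hD0 | hD0
  · have hsub : Subsingleton A := by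
      rw [hD0, ENNReal.coe_zero, eq_comm, Metric.ediam_eq_zero_iff] at hD
      exact ⟨fun a b => hD (Set.mem_univ a) (Set.mem_univ b)⟩
    have : Fintype A := Fintype.ofSubsingleton (Classical.arbitrary A)
    exact (hone A id).trans le_add_self
  let r : ℕ → ℝ≥0 := fun k => D / 2 ^ k
  have hr0 : ∀ k, r k ≠ 0 := fun k => by simp only [r]; positivity
  let s : ℕ → Set A := fun k => Metric.minimalCover (r k) Set.univ
  have hfin : ∀ k, (s k).Finite := fun k => Metric.finite_minimalCover
  have : ∀ k, Fintype (s k) := fun k => (hfin k).fintype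
  have hcov : ∀ k (a : A), ∃ y ∈ s k, edist a y ≤ r k := fun k a =>
    Metric.isCover_minimalCover (coveringNumber_univ_ne_top hA (hr0 k)) (Set.mem_univ a)
  have hne : ∀ k, Nonempty (s k) := fun k => by
    obtain ⟨y, hy, -⟩ := hcov k (Classical.arbitrary A)
    exact ⟨⟨y, hy⟩⟩
  have hcard : ∀ k, sqrtLog (Metric.coveringNumber (r k) (Set.univ : Set A)) =
      ENNReal.ofReal (Real.sqrt (Real.log (Fintype.card (s k)))) := fun k => by
    rw [sqrtLog, if_neg (coveringNumber_univ_ne_top hA (hr0 k)),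
      ← Metric.encard_minimalCover (coveringNumber_univ_ne_top hA (hr0 k))]
    congr 4
    rw [← Set.ncard_eq_toFinset_card' (s k) |>.trans (Set.toFinset_card (s k))]
    rfl
  -- `p k a` is a point of the cover `s k` within `r k` of `a`, and the parent of a point of `s (k + 1)`:
  -- a chain has only as many links at level `k` as `s (k + 1)` has points
  choose p hps hp using hcov
  let mx : ℕ → Ω → ℝ≥0∞ := fun k ω => ⨆ x : s k, ‖G x ω‖ₑ
  have hmx : ∀ k, Measurable (mx k) := fun k => Measurable.iSup fun x => (hmeas x).enorm
  let τ : ℕ → ℝ≥0∞ := fun k => ENNReal.ofReal ((c * r k : ℝ≥0) * (Real.sqrt 2 *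
    Real.sqrt (Real.log (Fintype.card (s (k + 1)))) + 2))
  have hstep : ∀ k, l2Norm P (mx (k + 1)) ≤ l2Norm P (mx k) + τ k := by
    intro k
    let W : s (k + 1) → Ω → ℝ := fun x ω => G x ω - G (p k x) ω
    calc l2Norm P (mx (k + 1)) ≤ l2Norm P (fun ω => mx k ω + ⨆ x, ‖W x ω‖ₑ) := by
          refine l2Norm_mono fun ω => iSup_le fun x => ?_
          calc ‖G x ω‖ₑ = ‖G (p k x) ω + W x ω‖ₑ := by simp [W]
            _ ≤ ‖G (p k x) ω‖ₑ + ‖W x ω‖ₑ := enorm_add_le _ _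
            _ ≤ _ := add_le_add (le_iSup (fun y : s k => ‖G y ω‖ₑ) ⟨p k x, hps k x⟩)
                (le_iSup (fun x => ‖W x ω‖ₑ) x)
      _ ≤ l2Norm P (mx k) + l2Norm P (fun ω => ⨆ x, ‖W x ω‖ₑ) :=
          l2Norm_add_le (hmx k).aemeasurable
            (Measurable.iSup fun x => ((hmeas _).sub (hmeas _)).enorm).aemeasurable
      _ ≤ _ := by
          gcongr
          refine l2Norm_iSup_le_of_hasSubgaussianMGF fun x => (hc x (p k x)).mono ?_
          gcongr
          have := hp k x
          rwa [edist_nndist, ENNReal.coe_le_coe] at this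
  -- the first cover is a single point, as its radius is the diameter
  have hzero : l2Norm P (mx 0) ≤ 2 * b := by
    have : Subsingleton (s 0) := by
      rw [Set.subsingleton_coe, ← Set.encard_le_one_iff_subsingleton, Metric.encard_minimalCover
        (coveringNumber_univ_ne_top hA (hr0 0))]
      refine Metric.coveringNumber_le_one_of_ediam_le ?_
      simp [r, ← hD]
    exact hone (s 0) Subtype.val
  have hsum : ∀ m, l2Norm P (mx m) ≤ 2 * b + ∑ k ∈ Finset.range m, τ k := by
    intro m
    induction m with
    | zero => simpa using hzero
    | succ m ih =>
      rw [Finset.sum_range_succ, ← add_assoc]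
      exact (hstep m).trans (by gcongr)
  have hτ : ∀ m, ∑ k ∈ Finset.range m, τ k ≤ c * (6 * dudleyIntegral A + 4 * D) := by
    intro m
    have hτk : ∀ k, τ k ≤ c * (ENNReal.ofReal (3 / 2) * (ENNReal.ofReal ((D : ℝ) / 2 ^ k) *
        sqrtLog (Metric.coveringNumber (r (k + 1)) (Set.univ : Set A))) +
        ENNReal.ofReal (2 * D * (1 / 2) ^ k)) := by
      intro k
      rw [hcard, ← ENNReal.ofReal_coe_nnreal, ← ENNReal.ofReal_mul (by positivity),
        ← ENNReal.ofReal_mul (by positivity), ← ENNReal.ofReal_add (by positivity) (by positivity),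
        ← ENNReal.ofReal_mul (by positivity)]
      refine ENNReal.ofReal_le_ofReal ?_
      have h2 : Real.sqrt 2 ≤ 3 / 2 := by
        rw [Real.sqrt_le_left (by norm_num)]; norm_num
      simp only [r]
      push_cast
      rw [mul_assoc]
      gcongr
      rw [mul_add]
      refine add_le_add ?_ (le_of_eq ?_)
      · rw [mul_left_comm]
        gcongr
      · rw [one_div, inv_pow]; field_simp
    calc _ ≤ ∑ k ∈ Finset.range m, c * (ENNReal.ofReal (3 / 2) *
          (ENNReal.ofReal ((D : ℝ) / 2 ^ k) *
          sqrtLog (Metric.coveringNumber (r (k + 1)) (Set.univ : Set A))) +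
          ENNReal.ofReal (2 * D * (1 / 2) ^ k)) := Finset.sum_le_sum fun k _ => hτk k
      _ = c * (ENNReal.ofReal (3 / 2) * ∑ k ∈ Finset.range m,
          (ENNReal.ofReal ((D : ℝ) / 2 ^ k) *
          sqrtLog (Metric.coveringNumber (r (k + 1)) (Set.univ : Set A))) +
          ∑ k ∈ Finset.range m, ENNReal.ofReal (2 * D * (1 / 2) ^ k)) := by
          rw [← Finset.mul_sum, Finset.sum_add_distrib, Finset.mul_sum]
      _ ≤ _ := by
          refine mul_le_mul_right (add_le_add ?_ ?_) _
          · calc _ ≤ ENNReal.ofReal (3 / 2) * (4 * dudleyIntegral A) :=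
                  mul_le_mul_right (sum_dyadic_sqrtLog_le_dudleyIntegral D hD m) _
              _ = _ := by
                  rw [← mul_assoc, show (4 : ℝ≥0∞) = ENNReal.ofReal 4 by simp,
                    ← ENNReal.ofReal_mul (by norm_num),
                    show (6 : ℝ≥0∞) = ENNReal.ofReal 6 by simp]
                  norm_num
          · rw [← ENNReal.ofReal_sum_of_nonneg fun k _ => by positivity, ← Finset.mul_sum,
              ← ENNReal.ofReal_coe_nnreal, show (4 : ℝ≥0∞) = ENNReal.ofReal 4 by simp,
              ← ENNReal.ofReal_mul (by norm_num)]
            refine ENNReal.ofReal_le_ofReal ?_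
            have := sum_geometric_two_le m
            nlinarith [D.coe_nonneg]
  -- chains of length `m` miss the supremum by at most `M * r m`, which tends to `0`
  have hfinal : ∀ m, l2Norm P (fun ω => ⨆ a, ‖G a ω‖ₑ) ≤
      2 * b + c * (6 * dudleyIntegral A + 4 * D) + M * r m := by
    intro m
    calc l2Norm P (fun ω => ⨆ a, ‖G a ω‖ₑ) ≤ l2Norm P (fun ω => mx m ω + M * r m) := by
          refine l2Norm_mono fun ω => iSup_le fun a => ?_
          calc ‖G a ω‖ₑ = ‖G (p m a) ω + (G a ω - G (p m a) ω)‖ₑ := by simp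
            _ ≤ ‖G (p m a) ω‖ₑ + ‖G a ω - G (p m a) ω‖ₑ := enorm_add_le _ _
            _ ≤ _ := by
              refine add_le_add (le_iSup (fun y : s m => ‖G y ω‖ₑ) ⟨p m a, hps m a⟩)
                ((hM ω _ _).trans ?_)
              gcongr
              exact hp m a
      _ ≤ l2Norm P (mx m) + M * r m := by
          refine (l2Norm_add_le (hmx m).aemeasurable aemeasurable_const).trans ?_
          rw [l2Norm_const]
      _ ≤ _ := by
          gcongr
          exact (hsum m).trans (by gcongr; exact hτ m)
  have hlim : Filter.Tendsto (fun m => 2 * (b : ℝ≥0∞) + c * (6 * dudleyIntegral A + 4 * D) +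
      M * r m) Filter.atTop (nhds (2 * b + c * (6 * dudleyIntegral A + 4 * D) + 0)) := by
    refine Filter.Tendsto.const_add _ ?_
    have : Filter.Tendsto (fun m => M * r m) Filter.atTop (nhds 0) := by
      rw [← NNReal.tendsto_coe]
      have h := (tendsto_pow_atTop_nhds_zero_of_lt_one (r := (1 / 2 : ℝ)) (by norm_num)
        (by norm_num)).const_mul ((M : ℝ) * D)
      refine (h.congr fun m => ?_).trans (by simp)
      simp only [r]; push_cast
      rw [one_div, inv_pow]; ring
    have h := ENNReal.tendsto_coe.2 this
    simpa using h
  have := ge_of_tendsto' hlim hfinal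
  rwa [add_zero, add_comm, hD] at this

end Dudley

/-! ### Suprema of uniformly Lipschitz families -/

lemma abs_ciSup_sub_ciSup_le {A : Type*} [Nonempty A] {f g : A → ℝ} {c : ℝ}
    (hf : BddAbove (Set.range f)) (hg : BddAbove (Set.range g)) (h : ∀ a, |f a - g a| ≤ c) :
    |(⨆ a, f a) - ⨆ a, g a| ≤ c := by
  rw [abs_sub_le_iff]
  constructor
  · rw [sub_le_iff_le_add]
    refine ciSup_le fun a => ?_
    linarith [(abs_le.1 (h a)).2, le_ciSup hg a]
  · rw [sub_le_iff_le_add]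
    refine ciSup_le fun a => ?_
    linarith [(abs_le.1 (h a)).1, le_ciSup hf a]

lemma bddAbove_range_of_abs_le {A : Type*} {f : A → ℝ} {B : ℝ} (h : ∀ a, |f a| ≤ B) :
    BddAbove (Set.range f) :=
  ⟨B, by rintro _ ⟨a, rfl⟩; exact (le_abs_self _).trans (h a)⟩

lemma abs_ciSup_le {A : Type*} [Nonempty A] {f : A → ℝ} {B : ℝ} (h : ∀ a, |f a| ≤ B) :
    |⨆ a, f a| ≤ B := by
  rw [abs_le]
  refine ⟨?_, ciSup_le fun a => (le_abs_self _).trans (h a)⟩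
  obtain ⟨a⟩ := ‹Nonempty A›
  exact (abs_le.1 (h a)).1.trans (le_ciSup (bddAbove_range_of_abs_le h) a)

section Metric

variable {S : Type u} {A : Type v} [MetricSpace S] [MeasurableSpace S] [OpensMeasurableSpace S]
  [MeasurableSpace A]

omit [MeasurableSpace S] [OpensMeasurableSpace S] in
lemma continuous_of_abs_sub_le {V : S → ℝ} {L : ℝ} (h : ∀ x y, |V x - V y| ≤ L * dist x y) :
    Continuous V :=
  (LipschitzWith.of_dist_le' h).continuous

lemma measurable_of_abs_sub_le {V : S → ℝ} {L : ℝ} (h : ∀ x y, |V x - V y| ≤ L * dist x y) :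
    Measurable V :=
  (continuous_of_abs_sub_le h).measurable

/-- Nearly optimal actions can be chosen measurably, whatever the `σ`-algebra on the actions is:
on a small ball around a point of a countable dense set, one action serves all states. -/
lemma exists_measurable_nearly_optimal [SecondCountableTopology S] [Nonempty A] {f : S → A → ℝ}
    {B L : ℝ} (hB : ∀ x a, f x a ≤ B) (hL : ∀ x x' a, |f x a - f x' a| ≤ L * dist x x')
    {ε : ℝ} (hε : 0 < ε) :
    ∃ g : S → A, Measurable g ∧ ∀ x a, f x a ≤ f x (g x) + ε := by
  rcases isEmpty_or_nonempty S with hS | hS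
  · exact ⟨isEmptyElim, measurable_of_empty _, isEmptyElim⟩
  let s := TopologicalSpace.denseSeq S
  have hs : DenseRange s := TopologicalSpace.denseRange_denseSeq S
  have hbdd : ∀ x, BddAbove (Set.range (f x)) := fun x => ⟨B, by rintro _ ⟨a, rfl⟩; exact hB x a⟩
  have hchoice : ∀ j, ∃ a, ∀ a', f (s j) a' ≤ f (s j) a + ε / 3 := by
    intro j
    obtain ⟨a, ha⟩ := exists_lt_of_lt_ciSup
      (show (⨆ a, f (s j) a) - ε / 3 < ⨆ a, f (s j) a by linarith)
    exact ⟨a, fun a' => by linarith [le_ciSup (hbdd (s j)) a']⟩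
  choose a ha using hchoice
  -- moving by less than `δ` changes `f · a` by at most `ε / 3`
  let δ : ℝ := ε / 3 / (|L| + 1)
  have hδ : 0 < δ := by positivity
  have hex : ∀ x, ∃ j, dist x (s j) < δ := fun x => hs.exists_dist_lt x hδ
  classical
  refine ⟨fun x => a (Nat.find (hex x)), ?_, fun x a' => ?_⟩
  · exact (measurable_of_countable a).comp (measurable_find hex fun j =>
      (isOpen_lt (continuous_id.dist continuous_const) continuous_const).measurableSet)
  · have hj : dist x (s (Nat.find (hex x))) < δ := Nat.find_spec (hex x)
    have hbound : ∀ a', |f x a' - f (s (Nat.find (hex x))) a'| ≤ ε / 3 := fun a' => by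
      refine (hL _ _ _).trans ?_
      calc L * dist x (s (Nat.find (hex x))) ≤ (|L| + 1) * δ := by
            refine mul_le_mul ?_ hj.le dist_nonneg (by positivity)
            linarith [le_abs_self L]
        _ = ε / 3 := by simp only [δ]; field_simp
    have h1 := (abs_le.1 (hbound a')).2
    have h2 := (abs_le.1 (hbound (a (Nat.find (hex x))))).1
    have h3 := ha (Nat.find (hex x)) a'
    linarith

end Metric

/-! ### The Bellman equation -/

namespace MDP

instance {S : Type u} {A : Type v} [MeasurableSpace S] [MeasurableSpace A] (M : MDP S A) (h : ℕ) :
    IsMarkovKernel (M.P h) := M.markov_P h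

instance {S : Type u} {A : Type v} [MeasurableSpace S] [MeasurableSpace A] (π : Policy S A)
    (t : ℕ) : IsMarkovKernel (π.kernel t) := π.markov t

section Value

variable {S : Type u} {A : Type v} [MeasurableSpace S] [MeasurableSpace A] (M : MDP S A)

omit M in
lemma measurable_finCons {X : Type*} [MeasurableSpace X] (n : ℕ) :
    Measurable fun q : X × (Fin n → X) => (Fin.cons q.1 q.2 : Fin (n + 1) → X) := by
  refine measurable_pi_iff.2 fun i => ?_
  refine Fin.cases ?_ (fun j => ?_) i
  · exact measurable_fst
  · simp only [Fin.cons_succ]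
    fun_prop

instance isMarkovKernel_pathLaw (π : Policy S A) (n h : ℕ) :
    IsMarkovKernel (M.pathLaw π n h) := by
  induction n generalizing h with
  | zero => exact Kernel.IsMarkovKernel.map _ (by fun_prop)
  | succ n ih =>
    have := ih (h + 1)
    exact Kernel.IsMarkovKernel.map _ (measurable_finCons _)

/-- The reward collected along a trajectory of `n + 1` state-action pairs that starts at
time `h`, the last state being paid by the terminal reward. -/
noncomputable def payoff (n h : ℕ) (ω : Fin (n + 1) → S × A) : ℝ :=
  (∑ i : Fin n, M.R (h + i) (ω i.castSucc)) + M.F (ω (Fin.last _)).1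

lemma measurable_payoff (n h : ℕ) : Measurable (M.payoff n h) := by
  refine Measurable.add ?_ (M.measurable_F.comp (by fun_prop))
  exact Finset.measurable_sum _ fun i _ => (M.measurable_R _).comp (by fun_prop)

lemma payoff_cons (n h : ℕ) (p : S × A) (ω : Fin (n + 1) → S × A) :
    M.payoff (n + 1) h (Fin.cons p ω) = M.R h p + M.payoff n (h + 1) ω := by
  simp only [payoff]
  rw [Fin.sum_univ_succ, add_assoc]
  congr 1
  congr 1
  refine Finset.sum_congr rfl fun i _ => ?_
  have : h + ((i.succ : Fin (n + 1)) : ℕ) = h + 1 + i := by simp; omega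
  rw [this, ← Fin.succ_castSucc, Fin.cons_succ]

lemma integral_payoff_zero (π : Policy S A) (h : ℕ) (x : S) :
    ∫ ω, M.payoff 0 h ω ∂(M.pathLaw π 0 h x) = M.F x := by
  have hm : Measurable fun p : S × A => M.payoff 0 h (fun _ => p) :=
    (M.measurable_payoff 0 h).comp (by fun_prop)
  rw [pathLaw, Kernel.map_apply _ (by fun_prop),
    integral_map (by fun_prop) (M.measurable_payoff _ _).aestronglyMeasurable,
    Kernel.prod_apply, Kernel.id_apply, Measure.dirac_prod,
    integral_map (by fun_prop) hm.aestronglyMeasurable]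
  simp [payoff]

variable {M} {Rmax : ℝ} (hR : ∀ h, h < M.H → ∀ (x : S) (a : A), |M.R h (x, a)| ≤ Rmax)
  (hF : ∀ x, |M.F x| ≤ Rmax)

include hR hF in
lemma abs_payoff_le {n h : ℕ} (hn : h + n ≤ M.H) (ω : Fin (n + 1) → S × A) :
    |M.payoff n h ω| ≤ (n + 1) * Rmax := by
  refine (abs_add_le _ _).trans ?_
  have : |∑ i : Fin n, M.R (h + i) (ω i.castSucc)| ≤ ∑ i : Fin n, Rmax :=
    (Finset.abs_sum_le_sum_abs _ _).trans (Finset.sum_le_sum fun i _ => hR _ (by omega) _ _)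
  simp only [Finset.sum_const, Finset.card_univ, Fintype.card_fin, nsmul_eq_mul] at this
  linarith [hF (ω (Fin.last _)).1]

include hR hF in
lemma integral_payoff_succ (π : Policy S A) {n h : ℕ} (hn : h + (n + 1) ≤ M.H) (x : S) :
    ∫ ω, M.payoff (n + 1) h ω ∂(M.pathLaw π (n + 1) h x) =
      ∫ a, (M.R h (x, a) + M.trans (h + 1) a
        (fun y => ∫ ω, M.payoff n (h + 1) ω ∂(M.pathLaw π n (h + 1) y)) x) ∂(π.kernel h x) := by
  have hmeas : Measurable fun q : (S × A) × (Fin (n + 1) → S × A) =>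
      (Fin.cons q.1 q.2 : Fin (n + 2) → S × A) := measurable_finCons _
  have hb : ∀ (p : S × A) (ω : Fin (n + 1) → S × A),
      |M.R h p + M.payoff n (h + 1) ω| ≤ Rmax + (n + 1) * Rmax := fun p ω =>
    (abs_add_le _ _).trans (add_le_add (hR h (by omega) _ _) (abs_payoff_le hR hF (by omega) ω))
  have hm2 : Measurable fun q : (S × A) × (Fin (n + 1) → S × A) =>
      M.R h q.1 + M.payoff n (h + 1) q.2 :=
    ((M.measurable_R h).comp measurable_fst).add ((M.measurable_payoff n _).comp measurable_snd)
  have hval : Measurable fun y : S =>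
      ∫ ω, M.payoff n (h + 1) ω ∂(M.pathLaw π n (h + 1) y) :=
    (M.measurable_payoff n (h + 1)).stronglyMeasurable.integral_kernel.measurable
  have hinner : ∀ p : S × A,
      ∫ ω, (M.R h p + M.payoff n (h + 1) ω) ∂((M.pathLaw π n (h + 1) ∘ₖ M.P (h + 1)) p) =
      M.R h p + ∫ y, (∫ ω, M.payoff n (h + 1) ω ∂(M.pathLaw π n (h + 1) y)) ∂(M.P (h + 1) p) := by
    intro p
    have hint : Integrable (M.payoff n (h + 1)) ((M.pathLaw π n (h + 1) ∘ₖ M.P (h + 1)) p) :=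
      Integrable.of_bound (M.measurable_payoff n _).aestronglyMeasurable _
        (ae_of_all _ fun ω => abs_payoff_le hR hF (by omega) ω)
    rw [integral_add (integrable_const _) hint, Kernel.integral_comp hint]
    simp
  have hm3 : Measurable fun p : S × A =>
      M.R h p + ∫ y, (∫ ω, M.payoff n (h + 1) ω ∂(M.pathLaw π n (h + 1) y)) ∂(M.P (h + 1) p) :=
    (M.measurable_R h).add hval.stronglyMeasurable.integral_kernel.measurable
  rw [pathLaw, Kernel.map_apply _ hmeas, integral_map hmeas.aemeasurable
    (M.measurable_payoff _ _).aestronglyMeasurable]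
  simp only [payoff_cons]
  rw [integral_compProd]
  · simp only [Kernel.prodMkLeft_apply, hinner]
    rw [Kernel.prod_apply, Kernel.id_apply, Measure.dirac_prod,
      integral_map (by fun_prop) hm3.aestronglyMeasurable]
    rfl
  · exact Integrable.of_bound hm2.aestronglyMeasurable _ (ae_of_all _ fun q => hb q.1 q.2)


/-- The solution of the Bellman recursion. -/
noncomputable def bellman (M : MDP S A) (h : ℕ) (x : S) : ℝ :=
  if h < M.H then ⨆ a : A, (M.R h (x, a) + M.trans (h + 1) a (M.bellman (h + 1)) x) else M.F x
termination_by M.H - h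

lemma bellman_of_lt {h : ℕ} (hh : h < M.H) (x : S) :
    M.bellman h x = ⨆ a : A, (M.R h (x, a) + M.trans (h + 1) a (M.bellman (h + 1)) x) := by
  rw [bellman, if_pos hh]

lemma bellman_of_not_lt {h : ℕ} (hh : ¬ h < M.H) : M.bellman h = M.F := by
  funext x
  rw [bellman, if_neg hh]

lemma _root_.abs_integral_le_of_abs_le {X : Type*} [MeasurableSpace X] {μ : Measure X}
    [IsProbabilityMeasure μ] {f : X → ℝ} {B : ℝ} (hf : ∀ x, |f x| ≤ B) : |∫ x, f x ∂μ| ≤ B := by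
  have := norm_integral_le_of_norm_le_const (μ := μ) (f := f) (C := B) (ae_of_all _ hf)
  simpa using! this

lemma abs_trans_le {V : S → ℝ} {B : ℝ} (hV : ∀ x, |V x| ≤ B) (h : ℕ) (a : A) (x : S) :
    |M.trans h a V x| ≤ B :=
  abs_integral_le_of_abs_le hV

lemma _root_.integrable_of_abs_le {X : Type*} [MeasurableSpace X] {μ : Measure X} [IsFiniteMeasure μ]
    {V : X → ℝ} {B : ℝ} (hm : Measurable V) (hV : ∀ x, |V x| ≤ B) : Integrable V μ :=
  Integrable.of_bound hm.aestronglyMeasurable B (ae_of_all _ hV)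

lemma trans_mono {V W : S → ℝ} {B C : ℝ} (hVm : Measurable V) (hWm : Measurable W)
    (hV : ∀ x, |V x| ≤ B) (hW : ∀ x, |W x| ≤ C) (hVW : ∀ x, V x ≤ W x) (h : ℕ) (a : A) (x : S) :
    M.trans h a V x ≤ M.trans h a W x :=
  integral_mono (integrable_of_abs_le hVm hV) (integrable_of_abs_le hWm hW) hVW

lemma measurable_trans {V : S → ℝ} (hV : Measurable V) (h : ℕ) :
    Measurable fun p : S × A => M.trans h p.2 V p.1 :=
  (hV.stronglyMeasurable.integral_kernel (κ := M.P h)).measurable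

end Value

section Lipschitz

variable {S : Type u} {A : Type v} {E : Type w}
  [MetricSpace S] [MeasurableSpace S] [OpensMeasurableSpace S] [MetricSpace A] [MeasurableSpace A]
  [MeasurableSpace E]

/-- The transitions are driven by noise with law `PE` through the maps `κ`, which are Lipschitz
with constant `ℓ` in the state and `ℓ'` in the action. -/
structure LipschitzNoise (M : MDP S A) (PE : Measure E) (κ : ℕ → S × A × E → S) (ℓ ℓ' : ℝ) :
    Prop where
  measurable : ∀ h, 1 ≤ h → h ≤ M.H → Measurable (κ h)
  law : ∀ h, 1 ≤ h → h ≤ M.H → ∀ (x : S) (a : A), M.P h (x, a) = PE.map (fun e => κ h (x, a, e))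
  dist_state : ∀ h, 1 ≤ h → h ≤ M.H → ∀ (x x' : S) (a : A) (e : E),
    dist (κ h (x, a, e)) (κ h (x', a, e)) ≤ ℓ * dist x x'
  dist_action : ∀ h, 1 ≤ h → h ≤ M.H → ∀ (x : S) (a a' : A) (e : E),
    dist (κ h (x, a, e)) (κ h (x, a', e)) ≤ ℓ' * dist a a'

/-- The rewards are bounded by `Rmax`, the running rewards are `LR`-Lipschitz in the state, and
the terminal reward is `LF`-Lipschitz. -/
structure LipschitzReward (M : MDP S A) (Rmax LR LF : ℝ) : Prop where
  abs_R_le : ∀ h, h < M.H → ∀ (x : S) (a : A), |M.R h (x, a)| ≤ Rmax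
  abs_F_le : ∀ x, |M.F x| ≤ Rmax
  lipschitz_R : ∀ h, h < M.H → ∀ (x x' : S) (a : A),
    |M.R h (x, a) - M.R h (x', a)| ≤ LR * dist x x'
  lipschitz_F : ∀ x x' : S, |M.F x - M.F x'| ≤ LF * dist x x'

variable {M : MDP S A} {PE : Measure E} [IsProbabilityMeasure PE] {κ : ℕ → S × A × E → S}
  {ℓ ℓ' Rmax LR LF : ℝ}

omit [OpensMeasurableSpace S] [IsProbabilityMeasure PE] in
lemma LipschitzNoise.measurable_section (hκ : M.LipschitzNoise PE κ ℓ ℓ') {h : ℕ} (h1 : 1 ≤ h)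
    (hH : h ≤ M.H) (x : S) (a : A) : Measurable fun e => κ h (x, a, e) :=
  (hκ.measurable h h1 hH).comp (by fun_prop)

omit [OpensMeasurableSpace S] [IsProbabilityMeasure PE] in
lemma LipschitzNoise.trans_eq (hκ : M.LipschitzNoise PE κ ℓ ℓ') {h : ℕ} (h1 : 1 ≤ h)
    (hH : h ≤ M.H) {V : S → ℝ} (hV : Measurable V) (a : A) (x : S) :
    M.trans h a V x = ∫ e, V (κ h (x, a, e)) ∂PE := by
  rw [MDP.trans, hκ.law h h1 hH, integral_map (hκ.measurable_section h1 hH x a).aemeasurable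
    hV.aestronglyMeasurable]

lemma LipschitzNoise.abs_trans_sub_le (hκ : M.LipschitzNoise PE κ ℓ ℓ') {h : ℕ} (h1 : 1 ≤ h)
    (hH : h ≤ M.H) {V : S → ℝ} {B L : ℝ} (hB : ∀ x, |V x| ≤ B) (hL0 : 0 ≤ L)
    (hL : ∀ x x', |V x - V x'| ≤ L * dist x x') {x x' : S} {a a' : A} {d : ℝ}
    (hd : ∀ e, dist (κ h (x, a, e)) (κ h (x', a', e)) ≤ d) :
    |M.trans h a V x - M.trans h a' V x'| ≤ L * d := by
  have hm := measurable_of_abs_sub_le hL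
  have hint : ∀ x a, Integrable (fun e => V (κ h (x, a, e))) PE := fun x a =>
    integrable_of_abs_le (hm.comp (hκ.measurable_section h1 hH x a)) fun e => hB _
  rw [hκ.trans_eq h1 hH hm, hκ.trans_eq h1 hH hm, ← integral_sub (hint x a) (hint x' a')]
  exact abs_integral_le_of_abs_le fun e =>
    (hL _ _).trans (mul_le_mul_of_nonneg_left (hd e) hL0)

lemma LipschitzNoise.abs_trans_sub_state (hκ : M.LipschitzNoise PE κ ℓ ℓ') {h : ℕ} (h1 : 1 ≤ h)
    (hH : h ≤ M.H) {V : S → ℝ} {B L : ℝ} (hB : ∀ x, |V x| ≤ B) (hL0 : 0 ≤ L)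
    (hL : ∀ x x', |V x - V x'| ≤ L * dist x x') (x x' : S) (a : A) :
    |M.trans h a V x - M.trans h a V x'| ≤ L * ℓ * dist x x' := by
  rw [mul_assoc]
  exact hκ.abs_trans_sub_le h1 hH hB hL0 hL fun e => hκ.dist_state h h1 hH x x' a e

lemma LipschitzNoise.abs_trans_sub_action (hκ : M.LipschitzNoise PE κ ℓ ℓ') {h : ℕ} (h1 : 1 ≤ h)
    (hH : h ≤ M.H) {V : S → ℝ} {B L : ℝ} (hB : ∀ x, |V x| ≤ B) (hL0 : 0 ≤ L)
    (hL : ∀ x x', |V x - V x'| ≤ L * dist x x') (x : S) (a a' : A) :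
    |M.trans h a V x - M.trans h a' V x| ≤ L * ℓ' * dist a a' := by
  rw [mul_assoc]
  exact hκ.abs_trans_sub_le h1 hH hB hL0 hL fun e => hκ.dist_action h h1 hH x a a' e

omit [OpensMeasurableSpace S] [MetricSpace A] in
lemma clipLevel_succ_add (H : ℕ) (Rmax : ℝ) (h : ℕ) :
    Rmax + clipLevel H Rmax (h + 1) = clipLevel H Rmax h := by
  simp only [clipLevel]; push_cast; ring

variable [Nonempty A]

omit [OpensMeasurableSpace S] [MetricSpace A] in
lemma LipschitzReward.abs_bellman_le (hR : M.LipschitzReward Rmax LR LF) {h : ℕ} (hh : h ≤ M.H)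
    (x : S) : |M.bellman h x| ≤ clipLevel M.H Rmax h := by
  induction hh using Nat.decreasingInduction generalizing x with
  | self => rw [bellman_of_not_lt (lt_irrefl _)]; simpa [clipLevel] using hR.abs_F_le x
  | of_succ h hh ih =>
    rw [bellman_of_lt hh]
    refine abs_ciSup_le fun a => ?_
    rw [← clipLevel_succ_add]
    exact (abs_add_le _ _).trans (add_le_add (hR.abs_R_le h hh x a) (abs_trans_le ih _ _ _))

lemma LipschitzReward.exists_lipschitz_bellman (hR : M.LipschitzReward Rmax LR LF)
    (hκ : M.LipschitzNoise PE κ ℓ ℓ') {h : ℕ} (hh : h ≤ M.H) :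
    ∃ L, 0 ≤ L ∧ ∀ x x', |M.bellman h x - M.bellman h x'| ≤ L * dist x x' := by
  induction hh using Nat.decreasingInduction with
  | self =>
    refine ⟨|LF|, abs_nonneg _, fun x x' => ?_⟩
    rw [bellman_of_not_lt (lt_irrefl _)]
    exact (hR.lipschitz_F x x').trans (by gcongr; exact le_abs_self _)
  | of_succ h hh ih =>
    obtain ⟨L, hL0, hL⟩ := ih
    have hB := fun x => hR.abs_bellman_le (Nat.succ_le_of_lt hh) x
    refine ⟨|LR + L * ℓ|, abs_nonneg _, fun x x' => ?_⟩
    rw [bellman_of_lt hh, bellman_of_lt hh]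
    have hb : ∀ x a, |M.R h (x, a) + M.trans (h + 1) a (M.bellman (h + 1)) x| ≤
        Rmax + clipLevel M.H Rmax (h + 1) := fun x a =>
      (abs_add_le _ _).trans (add_le_add (hR.abs_R_le h hh x a) (abs_trans_le hB _ _ _))
    refine abs_ciSup_sub_ciSup_le (bddAbove_range_of_abs_le (hb x))
      (bddAbove_range_of_abs_le (hb x')) fun a => ?_
    rw [add_sub_add_comm]
    refine (abs_add_le _ _).trans ?_
    refine (add_le_add (hR.lipschitz_R h hh x x' a)
      (hκ.abs_trans_sub_state (by omega) hh hB hL0 hL x x' a)).trans ?_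
    rw [← add_mul]
    gcongr
    exact le_abs_self _

lemma LipschitzReward.value_le_bellman (hR : M.LipschitzReward Rmax LR LF)
    (hκ : M.LipschitzNoise PE κ ℓ ℓ') (π : Policy S A) {n h : ℕ} (hn : h + n = M.H) (x : S) :
    ∫ ω, M.payoff n h ω ∂(M.pathLaw π n h x) ≤ M.bellman h x := by
  induction n generalizing h x with
  | zero =>
    rw [bellman_of_not_lt (by omega), integral_payoff_zero]
  | succ n ih =>
    have hh : h < M.H := by omega
    have hB := fun x => hR.abs_bellman_le (Nat.succ_le_of_lt hh) x
    obtain ⟨L, hL0, hL⟩ := hR.exists_lipschitz_bellman hκ (Nat.succ_le_of_lt hh)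
    have hval : Measurable fun y : S =>
        ∫ ω, M.payoff n (h + 1) ω ∂(M.pathLaw π n (h + 1) y) :=
      (M.measurable_payoff n (h + 1)).stronglyMeasurable.integral_kernel.measurable
    have hvalb : ∀ y, |∫ ω, M.payoff n (h + 1) ω ∂(M.pathLaw π n (h + 1) y)| ≤
        (n + 1) * Rmax := fun y =>
      abs_integral_le_of_abs_le fun ω =>
        abs_payoff_le hR.abs_R_le hR.abs_F_le (by omega) ω
    rw [integral_payoff_succ hR.abs_R_le hR.abs_F_le π (by omega)]
    have hb : ∀ a, M.R h (x, a) + M.trans (h + 1) a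
        (fun y => ∫ ω, M.payoff n (h + 1) ω ∂(M.pathLaw π n (h + 1) y)) x ≤ M.bellman h x := by
      intro a
      rw [bellman_of_lt hh]
      refine le_trans ?_ (le_ciSup (f := fun a : A => M.R h (x, a) +
        M.trans (h + 1) a (M.bellman (h + 1)) x) (bddAbove_range_of_abs_le
        (B := Rmax + clipLevel M.H Rmax (h + 1)) fun a =>
          (abs_add_le _ _).trans (add_le_add (hR.abs_R_le h hh x a) (abs_trans_le hB _ _ _))) a)
      refine add_le_add le_rfl ?_
      exact trans_mono hval (measurable_of_abs_sub_le hL) hvalb hB (fun y => ih (by omega) y) _ _ _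
    calc _ ≤ ∫ a, M.bellman h x ∂(π.kernel h x) := by
          refine integral_mono ?_ (integrable_const _) hb
          refine integrable_of_abs_le (B := Rmax + (n + 1) * Rmax)
            (((M.measurable_R h).add (measurable_trans hval (h + 1))).comp
              measurable_prodMk_left) fun a => ?_
          exact (abs_add_le _ _).trans
            (add_le_add (hR.abs_R_le h hh x a) (abs_trans_le hvalb _ _ _))
      _ = _ := by simp

end Lipschitz

end MDP

namespace DetPolicy

/-- A deterministic policy, as a policy. -/
noncomputable def toPolicy {S : Type u} {A : Type v} [MeasurableSpace S] [MeasurableSpace A]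
    (π : DetPolicy S A) : Policy S A where
  kernel t := Kernel.deterministic (π.act t) (π.measurable_act t)
  markov _ := inferInstance

end DetPolicy

namespace MDP

variable {S : Type u} {A : Type v} {E : Type w}
  [MetricSpace S] [MeasurableSpace S] [OpensMeasurableSpace S] [MetricSpace A] [MeasurableSpace A]
  [MeasurableSpace E] {M : MDP S A} {PE : Measure E} [IsProbabilityMeasure PE]
  {κ : ℕ → S × A × E → S} {ℓ ℓ' Rmax LR LF : ℝ} [Nonempty A]

lemma LipschitzReward.bellman_le_value (hR : M.LipschitzReward Rmax LR LF)
    (hκ : M.LipschitzNoise PE κ ℓ ℓ') {π : DetPolicy S A} {ε : ℝ}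
    (hπ : ∀ h, h < M.H → ∀ x a, M.R h (x, a) + M.trans (h + 1) a (M.bellman (h + 1)) x ≤
      M.R h (x, π.act h x) + M.trans (h + 1) (π.act h x) (M.bellman (h + 1)) x + ε)
    {n h : ℕ} (hn : h + n = M.H) (x : S) :
    M.bellman h x ≤ ∫ ω, M.payoff n h ω ∂(M.pathLaw π.toPolicy n h x) + n * ε := by
  induction n generalizing h x with
  | zero =>
    rw [bellman_of_not_lt (by omega), integral_payoff_zero]
    simp
  | succ n ih =>
    have hh : h < M.H := by omega
    have hB := fun x => hR.abs_bellman_le (Nat.succ_le_of_lt hh) x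
    obtain ⟨L, hL0, hL⟩ := hR.exists_lipschitz_bellman hκ (Nat.succ_le_of_lt hh)
    set v : S → ℝ := fun y => ∫ ω, M.payoff n (h + 1) ω ∂(M.pathLaw π.toPolicy n (h + 1) y)
      with hv
    have hval : Measurable v :=
      (M.measurable_payoff n (h + 1)).stronglyMeasurable.integral_kernel.measurable
    have hvalb : ∀ y, |v y| ≤ (n + 1) * Rmax := fun y =>
      abs_integral_le_of_abs_le fun ω =>
        abs_payoff_le hR.abs_R_le hR.abs_F_le (by omega) ω
    rw [integral_payoff_succ hR.abs_R_le hR.abs_F_le π.toPolicy (by omega)]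
    have hdet : ∫ a, (M.R h (x, a) + M.trans (h + 1) a v x) ∂(π.toPolicy.kernel h x) =
        M.R h (x, π.act h x) + M.trans (h + 1) (π.act h x) v x :=
      Kernel.integral_deterministic' (π.measurable_act h)
        (((M.measurable_R h).add (measurable_trans hval (h + 1))).comp
          measurable_prodMk_left).stronglyMeasurable
    rw [hdet]
    have htr : M.trans (h + 1) (π.act h x) (M.bellman (h + 1)) x ≤
        M.trans (h + 1) (π.act h x) v x + n * ε := by
      have h1 : M.trans (h + 1) (π.act h x) (fun y => v y + n * ε) x =
          M.trans (h + 1) (π.act h x) v x + n * ε := by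
        rw [MDP.trans, integral_add (integrable_of_abs_le hval hvalb) (integrable_const _)]
        simp [MDP.trans]
      rw [← h1]
      refine trans_mono (measurable_of_abs_sub_le hL) (hval.add_const _) hB
        (C := (n + 1) * Rmax + |n * ε|) (fun y => (abs_add_le _ _).trans ?_)
        (fun y => ih (by omega) y) _ _ _
      gcongr
      exact hvalb y
    rw [bellman_of_lt hh]
    refine ciSup_le fun a => (hπ h hh x a).trans ?_
    push_cast
    linarith

/-- The optimal values solve the Bellman recursion. -/
lemma LipschitzReward.optValue_eq_bellman [SecondCountableTopology S]
    (hR : M.LipschitzReward Rmax LR LF) (hκ : M.LipschitzNoise PE κ ℓ ℓ') {h : ℕ} (hh : h ≤ M.H) :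
    M.optValue h = M.bellman h := by
  have hle : ∀ (π : Policy S A) x, M.value π h x ≤ M.bellman h x := fun π x =>
    hR.value_le_bellman hκ π (by omega) x
  funext x
  obtain ⟨a₀⟩ := ‹Nonempty A›
  have : Nonempty (Policy S A) :=
    ⟨(⟨fun _ _ => a₀, fun _ => measurable_const⟩ : DetPolicy S A).toPolicy⟩
  refine le_antisymm (ciSup_le fun π => hle π x) ?_
  refine le_of_forall_pos_le_add fun ε hε => ?_
  have hε' : 0 < ε / (M.H + 1) := by positivity
  have hsel : ∀ t, ∃ g : S → A, Measurable g ∧ (t < M.H → ∀ x a,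
      M.R t (x, a) + M.trans (t + 1) a (M.bellman (t + 1)) x ≤
      M.R t (x, g x) + M.trans (t + 1) (g x) (M.bellman (t + 1)) x + ε / (M.H + 1)) := by
    intro t
    by_cases ht : t < M.H
    · have hB := fun x => hR.abs_bellman_le (Nat.succ_le_of_lt ht) x
      obtain ⟨L, hL0, hL⟩ := hR.exists_lipschitz_bellman hκ (Nat.succ_le_of_lt ht)
      obtain ⟨g, hg, hg'⟩ := exists_measurable_nearly_optimal
        (f := fun (x : S) (a : A) => M.R t (x, a) + M.trans (t + 1) a (M.bellman (t + 1)) x)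
        (B := Rmax + clipLevel M.H Rmax (t + 1)) (L := LR + L * ℓ)
        (fun x a => (le_abs_self _).trans ((abs_add_le _ _).trans
          (add_le_add (hR.abs_R_le t ht x a) (abs_trans_le hB _ _ _))))
        (fun x x' a => by
          rw [add_sub_add_comm, add_mul]
          exact (abs_add_le _ _).trans (add_le_add (hR.lipschitz_R t ht x x' a)
            (hκ.abs_trans_sub_state (by omega) ht hB hL0 hL x x' a))) hε'
      exact ⟨g, hg, fun _ => hg'⟩
    · exact ⟨fun _ => a₀, measurable_const, fun h => absurd h ht⟩
  choose g hg hg' using hsel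
  let π : DetPolicy S A := ⟨g, hg⟩
  have hval := hR.bellman_le_value hκ (π := π) hg' (n := M.H - h) (h := h) (by omega) x
  have hsup : M.value π.toPolicy h x ≤ M.optValue h x :=
    le_ciSup (f := fun π : Policy S A => M.value π h x)
      ⟨M.bellman h x, by rintro _ ⟨π, rfl⟩; exact hle π x⟩ _
  -- each of the at most `M.H` steps costs `ε / (M.H + 1)`
  have hsmall : ((M.H - h : ℕ) : ℝ) * (ε / (M.H + 1)) ≤ ε := by
    rw [mul_div_assoc', div_le_iff₀ (by positivity), mul_comm]
    gcongr
    have : ((M.H - h : ℕ) : ℝ) ≤ M.H := by exact_mod_cast Nat.sub_le _ _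
    linarith
  calc M.bellman h x ≤ M.value π.toPolicy h x + ((M.H - h : ℕ) : ℝ) * (ε / (M.H + 1)) := hval
    _ ≤ _ := add_le_add hsup hsmall

end MDP

/-! ### Elementary estimates for the algorithm -/

lemma abs_clip_le {L : ℝ} (hL : 0 ≤ L) (t : ℝ) : |clip L t| ≤ L := by
  rw [abs_le, clip]
  exact ⟨le_max_left _ _, max_le (by linarith) (min_le_left _ _)⟩

lemma abs_clip_sub_clip_le (L s t : ℝ) : |clip L s - clip L t| ≤ |s - t| := by
  unfold clip
  refine (abs_max_sub_max_le_max _ _ _ _).trans ?_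
  simpa using (abs_min_sub_min_le_max L s L t)

lemma clip_of_abs_le {L t : ℝ} (h : |t| ≤ L) : clip L t = t := by
  rw [clip, min_eq_right (abs_le.1 h).2, max_eq_right (abs_le.1 h).1]

lemma continuous_clip (L : ℝ) : Continuous (clip L) := by
  unfold clip; fun_prop

lemma clipLevel_nonneg {H : ℕ} {Rmax : ℝ} (hR : 0 ≤ Rmax) {h : ℕ} (hh : h ≤ H) :
    0 ≤ clipLevel H Rmax h := by
  have : (h : ℝ) ≤ H := by exact_mod_cast hh
  exact mul_nonneg (by linarith) hR

lemma clipLevel_le {H : ℕ} {Rmax : ℝ} (hR : 0 ≤ Rmax) (h : ℕ) :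
    clipLevel H Rmax h ≤ (H + 1) * Rmax := by
  have : (0 : ℝ) ≤ h := by positivity
  exact mul_le_mul_of_nonneg_right (by linarith) hR

lemma sum_abs_le_sqrt_card_mul_norm {K : ℕ} (v : EuclideanSpace ℝ (Fin K)) :
    ∑ k, |v k| ≤ Real.sqrt K * ‖v‖ := by
  rw [EuclideanSpace.norm_eq, ← Real.sqrt_mul (by positivity)]
  refine Real.le_sqrt_of_sq_le ?_
  have := sq_sum_le_card_mul_sum_sq (s := Finset.univ) (f := fun k => |v k|)
  simpa using this

section Algorithm

variable {S : Type u} {A : Type v} {E : Type w} {K N : ℕ} {γ : S → EuclideanSpace ℝ (Fin K)}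

lemma abs_linComb_sub_le {β : Fin K → ℝ} {B : ℝ} (hβ : ∀ k, |β k| ≤ B) (x x' : S) :
    |linComb γ β x - linComb γ β x'| ≤ B * (Real.sqrt K * ‖γ x - γ x'‖) := by
  rw [linComb, linComb, ← Finset.sum_sub_distrib]
  refine (Finset.abs_sum_le_sum_abs _ _).trans ?_
  calc ∑ k, |β k * γ x k - β k * γ x' k| ≤ ∑ k, B * |(γ x - γ x') k| := by
        refine Finset.sum_le_sum fun k _ => ?_
        rw [← mul_sub, abs_mul]
        exact mul_le_mul_of_nonneg_right (hβ k) (abs_nonneg _)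
    _ ≤ _ := by
        rw [← Finset.mul_sum]
        rcases isEmpty_or_nonempty (Fin K) with hK | ⟨⟨k⟩⟩
        · have : K = 0 := (Fintype.card_fin K).symm.trans (Fintype.card_eq_zero_iff.2 hK)
          subst this
          simp
        · exact mul_le_mul_of_nonneg_left (sum_abs_le_sqrt_card_mul_norm _)
            ((abs_nonneg _).trans (hβ k))

variable [MeasurableSpace S] {μ : Measure S} {κ : S × A × E → S} {V : S → ℝ} {Λ : ℝ}

lemma betaHat_apply (sample : Fin N → S × E) (a : A) (k : Fin K) :
    betaHat γ μ κ V sample a k = (N : ℝ)⁻¹ *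
      ∑ i, V (κ ((sample i).1, a, (sample i).2)) * dualBasis γ μ (sample i).1 k := by
  simp [betaHat, Finset.sum_apply]

lemma abs_inv_mul_sum_le (hN : 0 < N) {f : Fin N → ℝ} {B : ℝ} (hf : ∀ i, |f i| ≤ B) :
    |(N : ℝ)⁻¹ * ∑ i, f i| ≤ B := by
  have hN' : (0 : ℝ) < N := by exact_mod_cast hN
  rw [abs_mul, abs_of_pos (inv_pos.2 hN'), inv_mul_le_iff₀ hN']
  refine (Finset.abs_sum_le_sum_abs _ _).trans ?_
  refine (Finset.sum_le_sum fun i _ => hf i).trans ?_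
  simp

lemma abs_betaHat_le (hN : 0 < N) (hΛ : ∀ x, ‖dualBasis γ μ x‖ ≤ Λ) {B : ℝ}
    (hV : ∀ x, |V x| ≤ B) (sample : Fin N → S × E) (a : A) (k : Fin K) :
    |betaHat γ μ κ V sample a k| ≤ B * Λ := by
  rw [betaHat_apply]
  refine abs_inv_mul_sum_le hN fun i => ?_
  rw [abs_mul]
  exact mul_le_mul (hV _) ((norm_le_pi_norm _ k).trans (hΛ _)) (abs_nonneg _)
    ((abs_nonneg _).trans (hV (κ ((sample i).1, a, (sample i).2))))

lemma abs_betaHat_sub_le (hN : 0 < N) (hΛ : ∀ x, ‖dualBasis γ μ x‖ ≤ Λ) {a a' : A} {d : ℝ}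
    (hd0 : 0 ≤ d) (hd : ∀ x e, |V (κ (x, a, e)) - V (κ (x, a', e))| ≤ d)
    (sample : Fin N → S × E) (k : Fin K) :
    |betaHat γ μ κ V sample a k - betaHat γ μ κ V sample a' k| ≤ d * Λ := by
  rw [betaHat_apply, betaHat_apply, ← mul_sub, ← Finset.sum_sub_distrib]
  refine abs_inv_mul_sum_le hN fun i => ?_
  rw [← sub_mul, abs_mul]
  exact mul_le_mul (hd _ _) ((norm_le_pi_norm _ k).trans (hΛ _)) (abs_nonneg _) hd0

lemma continuous_betaHat [MetricSpace A] (hN : 0 < N) (hΛ : ∀ x, ‖dualBasis γ μ x‖ ≤ Λ) {L : ℝ}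
    (hL0 : 0 ≤ L) (hL : ∀ x e a a', |V (κ (x, a, e)) - V (κ (x, a', e))| ≤ L * dist a a')
    (sample : Fin N → S × E) : Continuous fun a => betaHat γ μ κ V sample a := by
  refine continuous_pi fun k => ?_
  refine (LipschitzWith.of_dist_le' (K := L * Λ) fun a a' => ?_).continuous
  rw [Real.dist_eq, mul_right_comm]
  exact abs_betaHat_sub_le hN hΛ (by positivity) (fun x e => hL x e a a') sample k

omit [MeasurableSpace S] in
lemma continuous_linComb_left (x : S) : Continuous fun β : Fin K → ℝ => linComb γ β x := by
  unfold linComb; fun_prop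

end Algorithm

/-- A supremum over an uncountable family `r a + g a ω`, where `g` is continuous in `a` and `r` is
arbitrary, is measurable: it can be taken over the countable set of points `a` for which the
points `(a, r a)` are dense in the graph of `r`. -/
lemma measurable_ciSup_add {A Ω : Type*} [MetricSpace A] [SecondCountableTopology A] [Nonempty A]
    [MeasurableSpace Ω] {r : A → ℝ} {g : A → Ω → ℝ} {B : ℝ} (hB : ∀ a ω, |r a + g a ω| ≤ B)
    (hg : ∀ a, Measurable (g a)) (hc : ∀ ω, Continuous fun a => g a ω) :
    Measurable fun ω => ⨆ a, (r a + g a ω) := by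
  let T : Set (A × ℝ) := Set.range fun a => (a, r a)
  have : Nonempty T := (Set.range_nonempty _).to_subtype
  let s := TopologicalSpace.denseSeq T
  have hs : DenseRange s := TopologicalSpace.denseRange_denseSeq T
  refine measurable_of_Ioi fun c => ?_
  have heq : (fun ω => ⨆ a, (r a + g a ω)) ⁻¹' Set.Ioi c =
      ⋃ j, {ω | c < (s j).1.2 + g (s j).1.1 ω} := by
    ext ω
    simp only [Set.mem_preimage, Set.mem_Ioi, Set.mem_iUnion, Set.mem_ofPred_eq]
    constructor
    · intro h
      obtain ⟨a, ha⟩ := exists_lt_of_lt_ciSup h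
      have hopen : IsOpen {t : T | c < t.1.2 + g t.1.1 ω} := by
        refine isOpen_lt continuous_const ?_
        exact (continuous_snd.comp continuous_subtype_val).add
          ((hc ω).comp (continuous_fst.comp continuous_subtype_val))
      exact hs.exists_mem_open hopen ⟨⟨(a, r a), a, rfl⟩, ha⟩
    · rintro ⟨j, hj⟩
      obtain ⟨a, ha⟩ := (s j).2
      rw [← ha] at hj
      exact hj.trans_le (le_ciSup (f := fun a => r a + g a ω)
        (bddAbove_range_of_abs_le fun a => hB a ω) a)
  rw [heq]
  exact MeasurableSet.iUnion fun j => measurableSet_lt measurable_const ((hg _).const_add _)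

/-! ### The estimated values -/

/-- The features `γ` are `Lγ`-Lipschitz and their dual features `Σ_h⁻¹ γ` are bounded by `Λ` in
the supremum norm. -/
structure FeatureBounds {S : Type u} [MetricSpace S] [MeasurableSpace S] {K : ℕ}
    (γ : S → EuclideanSpace ℝ (Fin K)) (μ : ℕ → Measure S) (H : ℕ) (Λ Lγ : ℝ) : Prop where
  lipschitz : ∀ x x' : S, ‖γ x - γ x'‖ ≤ Lγ * dist x x'
  norm_dualBasis_le : ∀ h, h < H → ∀ x : S, ‖dualBasis γ (μ h) x‖ ≤ Λ

section FeatureBounds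

variable {S : Type u} [MetricSpace S] [MeasurableSpace S] [OpensMeasurableSpace S] {K H : ℕ}
  {γ : S → EuclideanSpace ℝ (Fin K)} {μ : ℕ → Measure S} {Λ Lγ : ℝ}

omit [OpensMeasurableSpace S] in
lemma FeatureBounds.continuous (hγ : FeatureBounds γ μ H Λ Lγ) : Continuous γ :=
  (LipschitzWith.of_dist_le' (K := Lγ) fun x x' => by
    rw [dist_eq_norm]; exact hγ.lipschitz x x').continuous

lemma FeatureBounds.measurable_apply (hγ : FeatureBounds γ μ H Λ Lγ) (k : Fin K) :
    Measurable fun x => γ x k :=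
  ((by fun_prop : Continuous fun v : EuclideanSpace ℝ (Fin K) => v k).comp
    hγ.continuous).measurable

lemma FeatureBounds.measurable_dualBasis (hγ : FeatureBounds γ μ H Λ Lγ) (h : ℕ) (k : Fin K) :
    Measurable fun x => dualBasis γ (μ h) x k := by
  simp only [dualBasis, Matrix.mulVec, dotProduct]
  exact Finset.measurable_sum _ fun j _ => (hγ.measurable_apply j).const_mul _

end FeatureBounds

section ValueEst

variable {S : Type u} {A : Type v} {E : Type w} {K N : ℕ}
  [MetricSpace S] [MeasurableSpace S] [OpensMeasurableSpace S] [MetricSpace A] [MeasurableSpace A]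
  [MeasurableSpace E] {M : MDP S A} {PE : Measure E}
  {κ : ℕ → S × A × E → S} {μ : ℕ → Measure S} {γ : S → EuclideanSpace ℝ (Fin K)}
  {ℓ ℓ' Rmax LR LF Λ Lγ LV : ℝ}

omit [MetricSpace S] [OpensMeasurableSpace S] [MetricSpace A] [MeasurableSpace E] in
lemma valueEst_of_lt {data : Fin M.H → Fin N → S × E} {h : ℕ} (hh : h < M.H) (x : S) :
    valueEst M κ μ γ Rmax data h x =
      ⨆ a : A, (M.R h (x, a) + clip (clipLevel M.H Rmax (h + 1))
        (linComb γ (betaHat γ (μ h) (κ (h + 1)) (valueEst M κ μ γ Rmax data (h + 1))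
          (data ⟨h, hh⟩) a) x)) := by
  rw [valueEst, dif_pos hh]

omit [MetricSpace S] [OpensMeasurableSpace S] [MetricSpace A] [MeasurableSpace E] in
lemma valueEst_of_not_lt {data : Fin M.H → Fin N → S × E} {h : ℕ} (hh : ¬ h < M.H) :
    valueEst M κ μ γ Rmax data h = M.F := by
  funext x
  rw [valueEst, dif_neg hh]

omit [MetricSpace S] [OpensMeasurableSpace S] [MetricSpace A] [MeasurableSpace E] in
/-- The estimates at time `h` use only the data from time `h` on. -/
lemma valueEst_congr {data data' : Fin M.H → Fin N → S × E} {h : ℕ} (hh : h ≤ M.H)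
    (hd : ∀ t : Fin M.H, h ≤ t → data t = data' t) :
    valueEst M κ μ γ Rmax data h = valueEst M κ μ γ Rmax data' h := by
  induction hh using Nat.decreasingInduction with
  | self => rw [valueEst_of_not_lt (lt_irrefl _), valueEst_of_not_lt (lt_irrefl _)]
  | of_succ h hh ih =>
    funext x
    rw [valueEst_of_lt hh, valueEst_of_lt hh, ih fun t ht => hd t (by omega),
      hd ⟨h, hh⟩ le_rfl]

omit [MetricSpace S] [OpensMeasurableSpace S] [MetricSpace A] [MeasurableSpace E] in
/-- The estimates belong to the class over which the projection error takes its supremum. -/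
lemma exists_valueEst_eq_valueCoef (data : Fin M.H → Fin N → S × E) (h : ℕ) :
    ∃ ζ : A → Fin K → ℝ, valueEst M κ μ γ Rmax data h = valueCoef M γ Rmax ζ h := by
  by_cases hh : h < M.H
  · refine ⟨fun a => betaHat γ (μ h) (κ (h + 1)) (valueEst M κ μ γ Rmax data (h + 1))
      (data ⟨h, hh⟩) a, ?_⟩
    funext x
    rw [valueEst_of_lt hh, valueCoef, if_pos hh]
  · refine ⟨0, ?_⟩
    rw [valueEst_of_not_lt hh]
    funext x
    rw [valueCoef, if_neg hh]

variable [Nonempty A]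

omit [OpensMeasurableSpace S] [MetricSpace A] [Nonempty A] in
lemma MDP.LipschitzReward.abs_add_clip_le (hR : M.LipschitzReward Rmax LR LF) (hRmax : 0 ≤ Rmax)
    {h : ℕ} (hh : h < M.H) (x : S) (a : A) (t : ℝ) :
    |M.R h (x, a) + clip (clipLevel M.H Rmax (h + 1)) t| ≤ clipLevel M.H Rmax h := by
  rw [← clipLevel_succ_add M.H Rmax h]
  exact (abs_add_le _ _).trans (add_le_add (hR.abs_R_le h hh x a)
    (abs_clip_le (clipLevel_nonneg hRmax hh) _))

omit [OpensMeasurableSpace S] [MetricSpace A] [MeasurableSpace E] in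
lemma MDP.LipschitzReward.abs_valueEst_le (hR : M.LipschitzReward Rmax LR LF) (hRmax : 0 ≤ Rmax)
    (data : Fin M.H → Fin N → S × E) {h : ℕ} (hh : h ≤ M.H) (x : S) :
    |valueEst M κ μ γ Rmax data h x| ≤ clipLevel M.H Rmax h := by
  rcases hh.lt_or_eq with hh | rfl
  · rw [valueEst_of_lt hh]
    exact abs_ciSup_le fun a => hR.abs_add_clip_le hRmax hh x a _
  · rw [valueEst_of_not_lt (lt_irrefl _)]
    simpa [clipLevel] using hR.abs_F_le x

omit [OpensMeasurableSpace S] [MetricSpace A] [MeasurableSpace E] in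
/-- The estimates are Lipschitz in the state with a constant that does not depend on the data. -/
lemma MDP.LipschitzReward.lipschitz_valueEst (hR : M.LipschitzReward Rmax LR LV)
    (hRmax : 0 ≤ Rmax) (hγ : FeatureBounds γ μ M.H Λ Lγ) (hΛ : 0 ≤ Λ) (hN : 0 < N)
    (hLV : LV = LR + (M.H + 1) * Rmax * Λ * Lγ * Real.sqrt K)
    (data : Fin M.H → Fin N → S × E) {h : ℕ} (hh : h ≤ M.H) (x x' : S) :
    |valueEst M κ μ γ Rmax data h x - valueEst M κ μ γ Rmax data h x'| ≤ LV * dist x x' := by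
  rcases hh.lt_or_eq with hh | rfl
  · rw [valueEst_of_lt hh, valueEst_of_lt hh]
    refine abs_ciSup_sub_ciSup_le
      (bddAbove_range_of_abs_le fun a => hR.abs_add_clip_le hRmax hh x a _)
      (bddAbove_range_of_abs_le fun a => hR.abs_add_clip_le hRmax hh x' a _) fun a => ?_
    rw [add_sub_add_comm, hLV, add_mul]
    refine (abs_add_le _ _).trans (add_le_add (hR.lipschitz_R h hh x x' a) ?_)
    refine (abs_clip_sub_clip_le _ _ _).trans ?_
    refine (abs_linComb_sub_le (B := (M.H + 1) * Rmax * Λ) (fun k => ?_) x x').trans ?_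
    · exact abs_betaHat_le hN (hγ.norm_dualBasis_le h hh) (fun y =>
        (hR.abs_valueEst_le hRmax data hh y).trans (clipLevel_le hRmax _)) _ _ _
    · calc _ ≤ (M.H + 1) * Rmax * Λ * (Real.sqrt K * (Lγ * dist x x')) := by
            gcongr
            exact hγ.lipschitz x x'
        _ = _ := by ring
  · rw [valueEst_of_not_lt (lt_irrefl _)]
    exact hR.lipschitz_F x x'

omit [Nonempty A] in
lemma measurable_betaHat [IsProbabilityMeasure PE] (hκ : M.LipschitzNoise PE κ ℓ ℓ')
    (hγ : FeatureBounds γ μ M.H Λ Lγ) {h : ℕ} (hh : h < M.H)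
    {V : (Fin M.H → Fin N → S × E) → S → ℝ} (hV : Measurable (Function.uncurry V)) (a : A)
    (k : Fin K) :
    Measurable fun data : Fin M.H → Fin N → S × E =>
      betaHat γ (μ h) (κ (h + 1)) (V data) (data ⟨h, hh⟩) a k := by
  simp only [betaHat_apply]
  refine Measurable.const_mul (Finset.measurable_sum _ fun i _ => ?_) _
  have hκm := hκ.measurable (h + 1) (by omega) hh
  refine Measurable.mul (hV.comp (measurable_id.prodMk (hκm.comp ?_)))
    ((hγ.measurable_dualBasis h k).comp ?_) <;> fun_prop

/-- The estimates are jointly measurable in the data and the state. -/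
lemma measurable_valueEst [SecondCountableTopology S] [SecondCountableTopology A]
    [IsProbabilityMeasure PE]
    (hκ : M.LipschitzNoise PE κ ℓ ℓ') (hℓ' : 0 ≤ ℓ') (hR : M.LipschitzReward Rmax LR LV)
    (hRmax : 0 ≤ Rmax) (hγ : FeatureBounds γ μ M.H Λ Lγ) (hΛ : 0 ≤ Λ) (hN : 0 < N)
    (hLV0 : 0 ≤ LV) (hLV : LV = LR + (M.H + 1) * Rmax * Λ * Lγ * Real.sqrt K)
    {h : ℕ} (hh : h ≤ M.H) :
    Measurable (Function.uncurry fun (data : Fin M.H → Fin N → S × E) x =>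
      valueEst M κ μ γ Rmax data h x) := by
  induction hh using Nat.decreasingInduction with
  | self =>
    simp only [valueEst_of_not_lt (lt_irrefl _)]
    exact M.measurable_F.comp measurable_snd
  | of_succ h hh ih =>
    suffices hsw : Measurable (Function.uncurry fun x (data : Fin M.H → Fin N → S × E) =>
        valueEst M κ μ γ Rmax data h x) from hsw.comp measurable_swap
    refine measurable_uncurry_of_continuous_of_measurable (fun data =>
      continuous_of_abs_sub_le
        (hR.lipschitz_valueEst hRmax hγ hΛ hN hLV data hh.le)) fun x => ?_
    simp only [valueEst_of_lt hh]
    refine measurable_ciSup_add (r := fun a => M.R h (x, a)) (B := clipLevel M.H Rmax h)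
      (fun a data => hR.abs_add_clip_le hRmax hh x a _) (fun a => ?_) fun data => ?_
    · refine (continuous_clip _).measurable.comp ?_
      simp only [linComb]
      exact Finset.measurable_sum _ fun k _ =>
        (measurable_betaHat hκ hγ hh ih a k).mul_const _
    · refine (continuous_clip _).comp ((continuous_linComb_left x).comp ?_)
      refine continuous_betaHat hN (hγ.norm_dualBasis_le h hh) (L := LV * ℓ')
        (by positivity) (fun x e a a' => ?_) _
      refine (hR.lipschitz_valueEst hRmax hγ hΛ hN hLV data hh _ _).trans ?_
      rw [mul_assoc]
      exact mul_le_mul_of_nonneg_left (hκ.dist_action (h + 1) (by omega) hh x a a' e) hLV0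

end ValueEst

/-! ### Least squares -/

section LeastSquares

variable {S : Type u} [MeasurableSpace S] {K : ℕ} {γ : S → EuclideanSpace ℝ (Fin K)}
  {μ : Measure S} {g : S → ℝ}

lemma memLp_linComb (hγ : ∀ k, MemLp (fun x => γ x k) 2 μ) (β : Fin K → ℝ) :
    MemLp (linComb γ β) 2 μ := by
  unfold linComb
  exact memLp_finsetSum _ fun k _ => (hγ k).const_mul (β k)

lemma integral_mul_linComb (hγ : ∀ k, MemLp (fun x => γ x k) 2 μ) (hg : MemLp g 2 μ)
    (β : Fin K → ℝ) : ∫ x, g x * linComb γ β x ∂μ = ∑ k, β k * ∫ x, g x * γ x k ∂μ := by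
  simp only [linComb, Finset.mul_sum]
  rw [integral_finsetSum]
  · refine Finset.sum_congr rfl fun k _ => ?_
    rw [← integral_const_mul]
    congr 1
    ext x
    ring
  · intro k _
    exact hg.integrable_mul ((hγ k).const_mul (β k))

lemma integral_linComb_mul (hγ : ∀ k, MemLp (fun x => γ x k) 2 μ) (β : Fin K → ℝ) (k : Fin K) :
    ∫ x, linComb γ β x * γ x k ∂μ = (Matrix.mulVec (gram γ μ) β) k := by
  have := integral_mul_linComb hγ (hγ k) β
  simp only [mul_comm (linComb γ β _)]
  rw [this]
  simp only [Matrix.mulVec, dotProduct, gram, Matrix.of_apply, mul_comm]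

/-- The least squares coefficients are unique and given by the normal equations. -/
lemma regCoef_apply (hγ : ∀ k, MemLp (fun x => γ x k) 2 μ) (hgram : IsUnit (gram γ μ))
    (hg : MemLp g 2 μ) (k : Fin K) :
    regCoef γ μ g k = ∫ x, g x * dualBasis γ μ x k ∂μ := by
  set b : Fin K → ℝ := fun k => ∫ x, g x * dualBasis γ μ x k ∂μ with hb
  have hdet : IsUnit (gram γ μ).det := (Matrix.isUnit_iff_isUnit_det _).1 hgram
  have hbm : b = Matrix.mulVec (gram γ μ)⁻¹ (fun k => ∫ x, g x * γ x k ∂μ) := by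
    funext k
    have := integral_mul_linComb hγ hg (fun j => (gram γ μ)⁻¹ k j)
    simpa only [linComb] using! this
  have hnormal : ∀ k, ∫ x, linComb γ b x * γ x k ∂μ = ∫ x, g x * γ x k ∂μ := by
    intro k
    rw [integral_linComb_mul hγ, hbm, Matrix.mulVec_mulVec, Matrix.mul_nonsing_inv _ hdet,
      Matrix.one_mulVec]
  -- Pythagoras, the residual of `b` being orthogonal to the features
  have hpyth : ∀ β : Fin K → ℝ, ∫ x, (linComb γ β x - g x) ^ 2 ∂μ =
      ∫ x, (linComb γ b x - g x) ^ 2 ∂μ + ∫ x, linComb γ (β - b) x ^ 2 ∂μ := by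
    intro β
    have hδ := memLp_linComb hγ (β - b)
    have hr : MemLp (fun x => linComb γ b x - g x) 2 μ := (memLp_linComb hγ b).sub hg
    have hcross : ∫ x, (linComb γ b x - g x) * linComb γ (β - b) x ∂μ = 0 := by
      rw [integral_mul_linComb hγ hr]
      refine Finset.sum_eq_zero fun k _ => ?_
      simp only [sub_mul]
      have h1 : Integrable (fun x => linComb γ b x * γ x k) μ :=
        (memLp_linComb hγ b).integrable_mul (hγ k)
      have h2 : Integrable (fun x => g x * γ x k) μ := hg.integrable_mul (hγ k)
      rw [integral_sub h1 h2, hnormal, sub_self, mul_zero]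
    have hexp : ∀ x, (linComb γ β x - g x) ^ 2 = ((linComb γ b x - g x) ^ 2 +
        2 * ((linComb γ b x - g x) * linComb γ (β - b) x)) + linComb γ (β - b) x ^ 2 := by
      intro x
      have : linComb γ β x = linComb γ b x + linComb γ (β - b) x := by
        simp only [linComb, ← Finset.sum_add_distrib, ← add_mul, Pi.sub_apply,
          add_sub_cancel]
      rw [this]; ring
    simp only [hexp]
    have hi : Integrable (fun x => (linComb γ b x - g x) * linComb γ (β - b) x) μ :=
      hr.integrable_mul hδ
    have h1 : Integrable (fun x => (linComb γ b x - g x) ^ 2 +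
        2 * ((linComb γ b x - g x) * linComb γ (β - b) x)) μ := hr.integrable_sq.add (hi.const_mul 2)
    rw [integral_add h1 hδ.integrable_sq, integral_add hr.integrable_sq (hi.const_mul 2),
      integral_const_mul, hcross, mul_zero, add_zero]
  have hmin : ∀ β' : Fin K → ℝ, ∫ x, (linComb γ (regCoef γ μ g) x - g x) ^ 2 ∂μ ≤
      ∫ x, (linComb γ β' x - g x) ^ 2 ∂μ := by
    refine Classical.epsilon_spec (p := fun β => ∀ β' : Fin K → ℝ,
      ∫ x, (linComb γ β x - g x) ^ 2 ∂μ ≤ ∫ x, (linComb γ β' x - g x) ^ 2 ∂μ) ⟨b, fun β' => ?_⟩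
    rw [hpyth β']
    exact le_add_of_nonneg_right (integral_nonneg fun x => sq_nonneg _)
  set δ := regCoef γ μ g - b with hδdef
  have hzero : ∫ x, linComb γ δ x ^ 2 ∂μ = 0 := by
    have h1 := hmin b
    rw [hpyth] at h1
    exact le_antisymm (by linarith) (integral_nonneg fun x => sq_nonneg _)
  have hae : ∀ᵐ x ∂μ, linComb γ δ x = 0 := by
    have := (integral_eq_zero_iff_of_nonneg (fun x => sq_nonneg (linComb γ δ x))
      (memLp_linComb hγ δ).integrable_sq).1 hzero
    filter_upwards [this] with x hx
    simpa using hx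
  have hG : Matrix.mulVec (gram γ μ) δ = 0 := by
    funext k
    rw [← integral_linComb_mul hγ, integral_congr_ae (g := fun _ => 0)]
    · simp
    · filter_upwards [hae] with x hx
      simp [hx]
  have hδ0 : δ = 0 := by
    have := congrArg (Matrix.mulVec (gram γ μ)⁻¹) hG
    rwa [Matrix.mulVec_mulVec, Matrix.nonsing_inv_mul _ hdet, Matrix.one_mulVec,
      Matrix.mulVec_zero] at this
  exact congrFun (sub_eq_zero.1 hδ0) k

end LeastSquares

/-! ### The sampling error of the regression coefficients -/

/-- The deviation of an empirical mean of `N` independent copies of a variable bounded by `C` is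
subgaussian with parameter `(C / √N)²`. -/
lemma hasSubgaussianMGF_average {X : Type*} [MeasurableSpace X] {Q : Measure X}
    [IsProbabilityMeasure Q] {N : ℕ} (hN : 0 < N) {f : X → ℝ} (hf : Measurable f) {C : ℝ}
    (hC : ∀ x, |f x| ≤ C) {σ : ℝ≥0} (hσ : C / Real.sqrt N ≤ σ) :
    HasSubgaussianMGF (fun ω : Fin N → X => (N : ℝ)⁻¹ * ∑ i, f (ω i) - ∫ x, f x ∂Q) (σ ^ 2)
      (Measure.pi fun _ => Q) := by
  have hN' : (0 : ℝ) < N := by exact_mod_cast hN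
  obtain ⟨x₀⟩ : Nonempty X := nonempty_of_isProbabilityMeasure Q
  have hC0 : 0 ≤ C := (abs_nonneg _).trans (hC x₀)
  have hone : HasSubgaussianMGF (fun x => f x - ∫ y, f y ∂Q) ((‖C - -C‖₊ / 2) ^ 2) Q :=
    hasSubgaussianMGF_of_mem_Icc hf.aemeasurable (ae_of_all _ fun x => abs_le.1 (hC x))
  have hsum : HasSubgaussianMGF (fun ω : Fin N → X => ∑ i, (f (ω i) - ∫ y, f y ∂Q))
      (∑ _i : Fin N, (‖C - -C‖₊ / 2) ^ 2) (Measure.pi fun _ => Q) := by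
    refine HasSubgaussianMGF.sum_of_iIndepFun (X := fun i (ω : Fin N → X) => f (ω i) - ∫ y, f y ∂Q)
      ?_ fun i _ => ?_
    · exact iIndepFun_pi (X := fun _ x => f x - ∫ y, f y ∂Q) fun i => (hf.sub_const _).aemeasurable
    · have hmp := measurePreserving_eval (fun _ : Fin N => Q) i
      have : HasSubgaussianMGF (fun x => f x - ∫ y, f y ∂Q) ((‖C - -C‖₊ / 2) ^ 2)
          ((Measure.pi fun _ : Fin N => Q).map (Function.eval i)) := by rwa [hmp.map_eq]
      exact HasSubgaussianMGF.of_map hmp.measurable.aemeasurable this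
  have hmul := hsum.const_mul (N : ℝ)⁻¹
  have hfun : (fun ω : Fin N → X => (N : ℝ)⁻¹ * ∑ i, (f (ω i) - ∫ y, f y ∂Q)) =
      fun ω : Fin N → X => (N : ℝ)⁻¹ * ∑ i, f (ω i) - ∫ x, f x ∂Q := by
    funext ω
    rw [Finset.sum_sub_distrib, mul_sub]
    simp only [Finset.sum_const, Finset.card_univ, Fintype.card_fin, nsmul_eq_mul]
    field_simp
  rw [hfun] at hmul
  refine hmul.mono ?_
  have h1 : (C / Real.sqrt N) ^ 2 ≤ (σ : ℝ) ^ 2 := by gcongr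
  rw [div_pow, Real.sq_sqrt hN'.le] at h1
  have hnorm : ((‖C - -C‖₊ : ℝ≥0) : ℝ) = 2 * C := by
    rw [coe_nnnorm, Real.norm_eq_abs, sub_neg_eq_add, abs_of_nonneg (by linarith), two_mul]
  have hval : ((∑ _i : Fin N, (‖C - -C‖₊ / 2) ^ 2 : ℝ≥0) : ℝ) = N * C ^ 2 := by
    rw [Finset.sum_const, Finset.card_univ, Fintype.card_fin, nsmul_eq_mul]
    push_cast [hnorm]
    ring
  change ((N : ℝ)⁻¹ ^ 2) * ((∑ _i : Fin N, (‖C - -C‖₊ / 2) ^ 2 : ℝ≥0) : ℝ) ≤ (σ : ℝ) ^ 2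
  rw [hval]
  calc ((N : ℝ)⁻¹ ^ 2) * (N * C ^ 2) = C ^ 2 / N := by field_simp
    _ ≤ _ := h1

section Sampling

variable {S : Type u} {A : Type v} {E : Type w} {K N : ℕ} [MeasurableSpace S]
  [MeasurableSpace E] [MetricSpace A] [Nonempty A] {γ : S → EuclideanSpace ℝ (Fin K)}
  {μ : Measure S} [IsProbabilityMeasure μ] {PE : Measure E} [IsProbabilityMeasure PE]
  {κ : S × A × E → S} {V : S → ℝ} {Λ B L : ℝ}

/-- The uniform error of the pseudo-regression coefficients, for a fixed function `V`, by
Dudley's bound for the empirical process indexed by the actions. -/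
lemma l2Norm_iSup_betaHat_sub_le (hA : TotallyBounded (Set.univ : Set A)) (hN : 0 < N)
    (hΛ : ∀ x, ‖dualBasis γ μ x‖ ≤ Λ) (hΛ0 : 0 ≤ Λ) (hB : ∀ x, |V x| ≤ B) (hL0 : 0 ≤ L)
    (hL : ∀ x e a a', |V (κ (x, a, e)) - V (κ (x, a', e))| ≤ L * dist a a')
    (hVm : ∀ a, Measurable fun p : S × E => V (κ (p.1, a, p.2))) (k : Fin K)
    (hdm : Measurable fun x => dualBasis γ μ x k) :
    l2Norm (Measure.pi fun _ : Fin N => μ.prod PE) (fun sample =>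
      ⨆ a, ‖betaHat γ μ κ V sample a k -
        ∫ x, (∫ e, V (κ (x, a, e)) ∂PE) * dualBasis γ μ x k ∂μ‖ₑ) ≤
    ENNReal.ofReal (Λ / Real.sqrt N) * (ENNReal.ofReal L *
      (6 * dudleyIntegral A + 4 * Metric.ediam (Set.univ : Set A)) + 2 * ENNReal.ofReal B) := by
  have hN' : (0 : ℝ) < N := by exact_mod_cast hN
  have hdb : ∀ x, |dualBasis γ μ x k| ≤ Λ := fun x => (norm_le_pi_norm _ k).trans (hΛ x)
  let Z : A → S × E → ℝ := fun a p => V (κ (p.1, a, p.2)) * dualBasis γ μ p.1 k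
  have hZm : ∀ a, Measurable (Z a) := fun a => (hVm a).mul (hdm.comp measurable_fst)
  have hB0 : 0 ≤ B := by
    obtain ⟨x⟩ : Nonempty S := nonempty_of_isProbabilityMeasure μ
    exact (abs_nonneg _).trans (hB x)
  have hZb : ∀ a p, |Z a p| ≤ B * Λ := fun a p => by
    simp only [Z, abs_mul]
    exact mul_le_mul (hB _) (hdb _) (abs_nonneg _) hB0
  have hZl : ∀ a a' p, |Z a p - Z a' p| ≤ L * dist a a' * Λ := fun a a' p => by
    simp only [Z, ← sub_mul, abs_mul]
    exact mul_le_mul (hL _ _ _ _) (hdb _) (abs_nonneg _) (by positivity)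
  have hZi : ∀ a, Integrable (Z a) (μ.prod PE) := fun a => integrable_of_abs_le (hZm a) (hZb a)
  have hmean : ∀ a, ∫ x, (∫ e, V (κ (x, a, e)) ∂PE) * dualBasis γ μ x k ∂μ =
      ∫ p, Z a p ∂(μ.prod PE) := fun a => by
    rw [integral_prod _ (hZi a)]
    simp only [Z, integral_mul_const]
  let G : A → (Fin N → S × E) → ℝ := fun a ω =>
    (N : ℝ)⁻¹ * ∑ i, Z a (ω i) - ∫ p, Z a p ∂(μ.prod PE)
  have hG : ∀ sample a, betaHat γ μ κ V sample a k -
      ∫ x, (∫ e, V (κ (x, a, e)) ∂PE) * dualBasis γ μ x k ∂μ = G a sample := fun sample a => by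
    rw [hmean, betaHat_apply]
  simp only [hG]
  have hGsub : ∀ a a' ω, G a ω - G a' ω =
      (N : ℝ)⁻¹ * ∑ i, (Z a (ω i) - Z a' (ω i)) - ∫ p, (Z a p - Z a' p) ∂(μ.prod PE) := by
    intro a a' ω
    rw [integral_sub (hZi a) (hZi a'), Finset.sum_sub_distrib]
    simp only [G]; ring
  refine (l2Norm_iSup_le_dudleyIntegral hA (G := G)
    (b := Real.toNNReal (B * Λ / Real.sqrt N)) (c := Real.toNNReal (L * Λ / Real.sqrt N))
    (M := Real.toNNReal (2 * (L * Λ))) ?_ ?_ ?_ ?_).trans (le_of_eq ?_)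
  · intro a
    refine (Measurable.const_mul (Finset.measurable_sum _ fun i _ => ?_) _).sub_const _
    exact (hZm a).comp (measurable_pi_apply i)
  · intro a
    exact hasSubgaussianMGF_average hN (hZm a) (hZb a) (Real.le_coe_toNNReal _)
  · intro a a'
    simp only [hGsub]
    refine hasSubgaussianMGF_average hN ((hZm a).sub (hZm a')) (hZl a a') ?_
    rw [NNReal.coe_mul, Real.coe_toNNReal _ (by positivity), coe_nndist]
    exact le_of_eq (by ring)
  · intro ω a a'
    rw [hGsub, edist_dist, Real.enorm_eq_ofReal_abs, ← ENNReal.ofReal_coe_nnreal,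
      Real.coe_toNNReal _ (by positivity), ← ENNReal.ofReal_mul (by positivity)]
    refine ENNReal.ofReal_le_ofReal ?_
    have h1 := abs_inv_mul_sum_le hN (fun i => hZl a a' (ω i))
    have h2 := abs_integral_le_of_abs_le (μ := μ.prod PE) (hZl a a')
    have := abs_sub ((N : ℝ)⁻¹ * ∑ i, (Z a (ω i) - Z a' (ω i)))
      (∫ p, (Z a p - Z a' p) ∂(μ.prod PE))
    linarith
  · rw [← ENNReal.ofReal, ← ENNReal.ofReal, mul_div_assoc, mul_div_assoc,
      ENNReal.ofReal_mul hL0, ENNReal.ofReal_mul hB0]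
    ring

end Sampling

/-! ### Propagation of errors along deterministic policies -/

lemma iSup_eq_iSup_of_denseRange {A ι : Type*} [TopologicalSpace A] {s : ι → A}
    (hs : DenseRange s) {f : A → ℝ≥0∞} (hf : Continuous f) : ⨆ a, f a = ⨆ j, f (s j) := by
  refine le_antisymm (iSup_le fun a => ?_) (iSup_le fun j => le_iSup f (s j))
  have hcl : IsClosed {a | f a ≤ ⨆ j, f (s j)} := isClosed_le hf continuous_const
  exact hs.induction_on a hcl fun j => le_iSup (fun j => f (s j)) j

namespace MDP

section Propagation

variable {S : Type u} {A : Type v} [MeasurableSpace S] [MeasurableSpace A] {M : MDP S A}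

instance isMarkovKernel_detKernel (π : DetPolicy S A) (h n : ℕ) :
    IsMarkovKernel (M.detKernel π h n) := by
  induction n with
  | zero => unfold detKernel; infer_instance
  | succ n ih => unfold detKernel; infer_instance

lemma lintegral_detKernel_succ (π : DetPolicy S A) (h n : ℕ) {f : S → ℝ≥0∞} (hf : Measurable f)
    (x : S) : ∫⁻ y, f y ∂(M.detKernel π h (n + 1) x) =
      ∫⁻ y, ∫⁻ w, f w ∂(M.P (h + n + 1) (y, π.act (h + n) y)) ∂(M.detKernel π h n x) := by
  rw [detKernel, Kernel.lintegral_comp _ _ _ hf]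
  simp only [Kernel.comap_apply]

/-- Unrolling a one-step error recursion along a policy. -/
lemma le_sum_lintegral_detKernel (π : DetPolicy S A) {d z : ℕ → S → ℝ≥0∞} {δ : ℝ≥0∞}
    (hd : ∀ t, t ≤ M.H → Measurable (d t))
    (hstep : ∀ t, t < M.H → ∀ x,
      d t x ≤ z t x + ∫⁻ y, d (t + 1) y ∂(M.P (t + 1) (x, π.act t x)) + δ)
    {h n : ℕ} (hn : h + n ≤ M.H) (x : S) :
    d h x ≤ ∑ i ∈ Finset.range n, ∫⁻ y, z (h + i) y ∂(M.detKernel π h i x) +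
      ∫⁻ y, d (h + n) y ∂(M.detKernel π h n x) + n * δ := by
  induction n with
  | zero => simp [detKernel, Kernel.id_apply, lintegral_dirac' _ (hd h (by omega))]
  | succ n ih =>
    refine (ih (by omega)).trans ?_
    have hP : Measurable fun y => ∫⁻ w, d (h + n + 1) w ∂(M.P (h + n + 1) (y, π.act (h + n) y)) :=
      ((hd (h + n + 1) (by omega)).lintegral_kernel (κ := M.P (h + n + 1))).comp
        (measurable_id.prodMk (π.measurable_act (h + n)))
    have h1 : ∫⁻ y, d (h + n) y ∂(M.detKernel π h n x) ≤
        ∫⁻ y, z (h + n) y ∂(M.detKernel π h n x) +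
          ∫⁻ y, d (h + (n + 1)) y ∂(M.detKernel π h (n + 1) x) + δ := by
      calc _ ≤ ∫⁻ y, (z (h + n) y +
            ∫⁻ w, d (h + n + 1) w ∂(M.P (h + n + 1) (y, π.act (h + n) y)) + δ)
              ∂(M.detKernel π h n x) := lintegral_mono fun y => hstep (h + n) (by omega) y
        _ = _ := by
            rw [lintegral_add_right _ measurable_const, lintegral_add_right _ hP,
              lintegral_detKernel_succ _ _ _ (hd _ (by omega)), lintegral_const, measure_univ,
              mul_one]
            rfl
    rw [Finset.sum_range_succ]
    calc _ ≤ ∑ i ∈ Finset.range n, ∫⁻ y, z (h + i) y ∂(M.detKernel π h i x) +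
          (∫⁻ y, z (h + n) y ∂(M.detKernel π h n x) +
          ∫⁻ y, d (h + (n + 1)) y ∂(M.detKernel π h (n + 1) x) + δ) + n * δ := by gcongr
      _ = _ := by push_cast; ring

variable {μ : ℕ → Measure S} [∀ h, IsProbabilityMeasure (μ h)]

omit [∀ h, IsProbabilityMeasure (μ h)] in
lemma detKernel_succ_absolutelyContinuous
    (hac : ∀ h, 1 ≤ h → h ≤ M.H → ∀ (x : S) (a : A), M.P h (x, a) ≪ μ h)
    (π : DetPolicy S A) {h n : ℕ} (hn : h + n + 1 ≤ M.H) (x : S) :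
    M.detKernel π h (n + 1) x ≪ μ (h + n + 1) := by
  refine Measure.AbsolutelyContinuous.mk fun s hs h0 => ?_
  rw [detKernel, Kernel.comp_apply' _ _ _ hs]
  simp only [Kernel.comap_apply]
  rw [lintegral_congr (g := fun _ => 0) fun y => hac _ (by omega) hn _ _ h0]
  simp

/-- The change of measure coefficient bounds the operator norms, between the `L²` spaces of the
reference measures, of the transition kernels of deterministic policies. -/
lemma l2Norm_lintegral_detKernel_le
    (hac : ∀ h, 1 ≤ h → h ≤ M.H → ∀ (x : S) (a : A), M.P h (x, a) ≪ μ h)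
    (π : DetPolicy S A) {h n : ℕ} (hn : h + n < M.H) {z : S → ℝ≥0∞} (hz : Measurable z)
    (hfin : l2Norm (μ (h + n)) z ≠ ⊤) :
    l2Norm (μ h) (fun x => ∫⁻ y, z y ∂(M.detKernel π h n x)) ≤
      max 1 (M.changeOfMeasure μ) * l2Norm (μ (h + n)) z := by
  cases n with
  | zero =>
    have : (fun x => ∫⁻ y, z y ∂(M.detKernel π h 0 x)) = z := by
      funext x
      rw [detKernel, Kernel.id_apply, lintegral_dirac' _ hz]
    rw [this]
    exact le_mul_of_one_le_left zero_le (le_max_left _ _)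
  | succ n =>
    rw [← add_assoc] at hfin hn ⊢
    have hR : (∫⁻ x, ∫⁻ y, ((M.detKernel π h (n + 1) x).rnDeriv (μ (h + n + 1)) y) ^ 2
        ∂(μ (h + n + 1)) ∂(μ h)) ^ (1 / 2 : ℝ) ≤ M.changeOfMeasure μ := by
      refine le_iSup_of_le π (le_iSup_of_le h (le_iSup_of_le (h + n + 1)
        (le_iSup_of_le (by omega) (le_iSup_of_le hn ?_))))
      rw [show h + n + 1 - h = n + 1 by omega]
    have hpt : ∀ x, (∫⁻ y, z y ∂(M.detKernel π h (n + 1) x)) ^ 2 ≤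
        (∫⁻ y, ((M.detKernel π h (n + 1) x).rnDeriv (μ (h + n + 1)) y) ^ 2 ∂(μ (h + n + 1))) *
          l2Norm (μ (h + n + 1)) z ^ 2 := by
      intro x
      have hac' := detKernel_succ_absolutelyContinuous hac π (show h + n + 1 ≤ M.H by omega) x
      rw [← lintegral_rnDeriv_mul hac' hz.aemeasurable, ← sq_l2Norm, ← mul_pow]
      gcongr
      have := ENNReal.lintegral_mul_le_Lp_mul_Lq (μ (h + n + 1)) Real.HolderConjugate.two_two
        (Measure.measurable_rnDeriv (M.detKernel π h (n + 1) x) (μ (h + n + 1))).aemeasurable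
        hz.aemeasurable
      simpa [l2Norm] using this
    rw [l2Norm_le_iff]
    calc _ ≤ ∫⁻ x, (∫⁻ y, ((M.detKernel π h (n + 1) x).rnDeriv (μ (h + n + 1)) y) ^ 2
          ∂(μ (h + n + 1))) * l2Norm (μ (h + n + 1)) z ^ 2 ∂(μ h) := lintegral_mono hpt
      _ = ((∫⁻ x, ∫⁻ y, ((M.detKernel π h (n + 1) x).rnDeriv (μ (h + n + 1)) y) ^ 2
          ∂(μ (h + n + 1)) ∂(μ h)) ^ (1 / 2 : ℝ)) ^ 2 * l2Norm (μ (h + n + 1)) z ^ 2 := by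
          -- the integrand need not be measurable in the starting point, but the factor is finite
          rw [lintegral_mul_const' _ _ (ENNReal.pow_ne_top hfin), ← ENNReal.rpow_natCast,
            ← ENNReal.rpow_natCast, ← ENNReal.rpow_mul]
          norm_num
      _ ≤ _ := by
          rw [mul_pow]
          gcongr
          exact hR.trans (le_max_right _ _)

end Propagation

end MDP

section OneStep

variable {S : Type u} {A : Type v} {E : Type w} {K : ℕ}
  [MetricSpace S] [SecondCountableTopology S] [MeasurableSpace S] [OpensMeasurableSpace S]
  [MetricSpace A] [Nonempty A] [MeasurableSpace A]
  [MeasurableSpace E] {M : MDP S A} {PE : Measure E} [IsProbabilityMeasure PE]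
  {κ : ℕ → S × A × E → S} {μ : ℕ → Measure S} [∀ h, IsProbabilityMeasure (μ h)]
  {γ : S → EuclideanSpace ℝ (Fin K)} {ℓ ℓ' Rmax LR LF Λ Lγ ϱ : ℝ}

/-- The error made at time `h` in the approximation, uniformly in the action, of the transition
operator applied to `U` by clipped linear combinations of the features. -/
noncomputable def stepError (M : MDP S A) (γ : S → EuclideanSpace ℝ (Fin K)) (Rmax : ℝ) (h : ℕ)
    (U : S → ℝ) (b : A → Fin K → ℝ) (x : S) : ℝ≥0∞ :=
  ⨆ a, ‖M.trans (h + 1) a U x - clip (clipLevel M.H Rmax (h + 1)) (linComb γ (b a) x)‖ₑ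

omit [SecondCountableTopology S] [Nonempty A] in
lemma measurable_stepError (hκ : M.LipschitzNoise PE κ ℓ ℓ') {h : ℕ} (hh : h < M.H)
    (hγ : Continuous γ) {U : S → ℝ} {B L : ℝ} (hB : ∀ x, |U x| ≤ B) (hL0 : 0 ≤ L)
    (hL : ∀ x x', |U x - U x'| ≤ L * dist x x') (b : A → Fin K → ℝ) :
    Measurable (stepError M γ Rmax h U b) := by
  refine LowerSemicontinuous.measurable (lowerSemicontinuous_iSup fun a => ?_)
  refine Continuous.lowerSemicontinuous (Continuous.enorm (Continuous.sub ?_ ?_))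
  · exact continuous_of_abs_sub_le fun x x' =>
      hκ.abs_trans_sub_state (by omega) hh hB hL0 hL x x' a
  · refine (continuous_clip _).comp ?_
    unfold linComb
    fun_prop

/-- One backward step of the error recursion, for a nearly optimal choice of actions. -/
lemma exists_policy_le_stepError (hκ : M.LipschitzNoise PE κ ℓ ℓ')
    (hR : M.LipschitzReward Rmax LR LF) (hRmax : 0 ≤ Rmax) {U : ℕ → S → ℝ}
    {b : ℕ → A → Fin K → ℝ} {L : ℝ} (hL0 : 0 ≤ L)
    (hUb : ∀ h, h ≤ M.H → ∀ x, |U h x| ≤ clipLevel M.H Rmax h)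
    (hUL : ∀ h, h ≤ M.H → ∀ x x', |U h x - U h x'| ≤ L * dist x x')
    (hU : ∀ h, h < M.H → ∀ x, U h x = ⨆ a, (M.R h (x, a) +
      clip (clipLevel M.H Rmax (h + 1)) (linComb γ (b h a) x)))
    {δ : ℝ} (hδ : 0 < δ) :
    ∃ π : DetPolicy S A, ∀ h, h < M.H → ∀ x, ‖M.bellman h x - U h x‖ₑ ≤
      stepError M γ Rmax h (U (h + 1)) (b h) x +
        ∫⁻ y, ‖M.bellman (h + 1) y - U (h + 1) y‖ₑ ∂(M.P (h + 1) (x, π.act h x)) +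
        ENNReal.ofReal δ := by
  have hstep : ∀ h, ∃ g : S → A, Measurable g ∧ (h < M.H → ∀ x, ‖M.bellman h x - U h x‖ₑ ≤
      stepError M γ Rmax h (U (h + 1)) (b h) x +
        ∫⁻ y, ‖M.bellman (h + 1) y - U (h + 1) y‖ₑ ∂(M.P (h + 1) (x, g x)) +
        ENNReal.ofReal δ) := by
    intro h
    by_cases hh : h < M.H
    swap
    · exact ⟨fun _ => Classical.arbitrary A, measurable_const, fun h' => absurd h' hh⟩
    set c := clipLevel M.H Rmax (h + 1) with hc
    have hc0 : 0 ≤ c := clipLevel_nonneg hRmax hh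
    have hBb : ∀ x, |M.bellman (h + 1) x| ≤ c := fun x => hR.abs_bellman_le hh x
    have hUb' : ∀ x, |U (h + 1) x| ≤ c := fun x => hUb (h + 1) hh x
    obtain ⟨L', hL'0, hL'⟩ := hR.exists_lipschitz_bellman hκ (Nat.succ_le_of_lt hh)
    have hUL' := hUL (h + 1) hh
    let D : S → ℝ := fun x => |M.bellman (h + 1) x - U (h + 1) x|
    have hDb : ∀ x, |D x| ≤ c + c := fun x => by
      simp only [D, abs_abs]
      exact (abs_sub _ _).trans (add_le_add (hBb x) (hUb' x))
    have hDL : ∀ x x', |D x - D x'| ≤ (L' + L) * dist x x' := fun x x' => by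
      refine (abs_abs_sub_abs_le_abs_sub _ _).trans ?_
      rw [sub_sub_sub_comm, add_mul]
      exact (abs_sub _ _).trans (add_le_add (hL' x x') (hUL' x x'))
    have hDm : Measurable D := measurable_of_abs_sub_le hDL
    obtain ⟨g, hg, hgD⟩ := exists_measurable_nearly_optimal
      (f := fun x (a : A) => M.trans (h + 1) a D x) (B := c + c) (L := (L' + L) * ℓ)
      (fun x a => (le_abs_self _).trans (MDP.abs_trans_le hDb _ _ _))
      (fun x x' a => hκ.abs_trans_sub_state (by omega) hh hDb (by positivity) hDL x x' a) hδ
    refine ⟨g, hg, fun _ x => ?_⟩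
    set z := stepError M γ Rmax h (U (h + 1)) (b h) x with hz
    have hzt : z ≠ ⊤ := by
      refine ne_top_of_le_ne_top (ENNReal.ofReal_ne_top (r := c + c)) (iSup_le fun a => ?_)
      rw [Real.enorm_eq_ofReal_abs]
      refine ENNReal.ofReal_le_ofReal ((abs_sub _ _).trans (add_le_add ?_ (abs_clip_le hc0 _)))
      exact MDP.abs_trans_le hUb' _ _ _
    have hza : ∀ a, |M.trans (h + 1) a (U (h + 1)) x - clip c (linComb γ (b h a) x)| ≤
        z.toReal := fun a => by
      rw [← ENNReal.ofReal_le_iff_le_toReal hzt, ← Real.enorm_eq_ofReal_abs]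
      exact le_iSup (fun a => ‖M.trans (h + 1) a (U (h + 1)) x -
        clip c (linComb γ (b h a) x)‖ₑ) a
    have hreal : |M.bellman h x - U h x| ≤ z.toReal + M.trans (h + 1) (g x) D x + δ := by
      rw [MDP.bellman_of_lt hh, hU h hh]
      refine abs_ciSup_sub_ciSup_le
        (bddAbove_range_of_abs_le (B := Rmax + c) fun a => (abs_add_le _ _).trans
          (add_le_add (hR.abs_R_le h hh x a) (MDP.abs_trans_le hBb _ _ _)))
        (bddAbove_range_of_abs_le fun a => hR.abs_add_clip_le hRmax hh x a _) fun a => ?_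
      rw [add_sub_add_left_eq_sub]
      have htr : |M.trans (h + 1) a (M.bellman (h + 1)) x - M.trans (h + 1) a (U (h + 1)) x| ≤
          M.trans (h + 1) a D x := by
        unfold MDP.trans
        rw [← integral_sub (integrable_of_abs_le (measurable_of_abs_sub_le hL') hBb)
          (integrable_of_abs_le (measurable_of_abs_sub_le hUL') hUb')]
        exact abs_integral_le_integral_abs
      have h1 := abs_sub_le (M.trans (h + 1) a (M.bellman (h + 1)) x)
        (M.trans (h + 1) a (U (h + 1)) x) (clip c (linComb γ (b h a) x))
      linarith [hza a, hgD x a]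
    rw [Real.enorm_eq_ofReal_abs]
    have hD0 : 0 ≤ M.trans (h + 1) (g x) D x := integral_nonneg fun y => abs_nonneg _
    calc _ ≤ ENNReal.ofReal (z.toReal + M.trans (h + 1) (g x) D x + δ) :=
          ENNReal.ofReal_le_ofReal hreal
      _ = _ := by
          rw [ENNReal.ofReal_add (by positivity) hδ.le, ENNReal.ofReal_add (by positivity) hD0,
            ENNReal.ofReal_toReal hzt, MDP.trans, ofReal_integral_eq_lintegral_ofReal
            (integrable_of_abs_le hDm hDb) (ae_of_all _ fun y => abs_nonneg _)]
          simp only [D, Real.enorm_eq_ofReal_abs]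
  choose g hg hg' using hstep
  exact ⟨⟨g, hg⟩, hg'⟩

/-- The error of approximate values is at most the sum of the errors made in the single steps,
up to the change of measure coefficient. -/
lemma l2Norm_bellman_sub_le_sum_stepError (hκ : M.LipschitzNoise PE κ ℓ ℓ')
    (hR : M.LipschitzReward Rmax LR LF) (hRmax : 0 ≤ Rmax) (hγ : Continuous γ)
    (hac : ∀ h, 1 ≤ h → h ≤ M.H → ∀ (x : S) (a : A), M.P h (x, a) ≪ μ h) {U : ℕ → S → ℝ}
    {b : ℕ → A → Fin K → ℝ} {L : ℝ} (hL0 : 0 ≤ L)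
    (hUb : ∀ h, h ≤ M.H → ∀ x, |U h x| ≤ clipLevel M.H Rmax h)
    (hUL : ∀ h, h ≤ M.H → ∀ x x', |U h x - U h x'| ≤ L * dist x x')
    (hU : ∀ h, h < M.H → ∀ x, U h x = ⨆ a, (M.R h (x, a) +
      clip (clipLevel M.H Rmax (h + 1)) (linComb γ (b h a) x))) (hUH : U M.H = M.F)
    {h : ℕ} (hh : h ≤ M.H) :
    l2Norm (μ h) (fun x => ‖M.bellman h x - U h x‖ₑ) ≤ max 1 (M.changeOfMeasure μ) *
      ∑ l ∈ Finset.Ico h M.H, l2Norm (μ l) (stepError M γ Rmax l (U (l + 1)) (b l)) := by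
  let d : ℕ → S → ℝ≥0∞ := fun t x => ‖M.bellman t x - U t x‖ₑ
  let z : ℕ → S → ℝ≥0∞ := fun t => stepError M γ Rmax t (U (t + 1)) (b t)
  have hd : ∀ t, t ≤ M.H → Measurable (d t) := fun t ht => by
    obtain ⟨L', -, hL'⟩ := hR.exists_lipschitz_bellman hκ ht
    exact ((measurable_of_abs_sub_le hL').sub (measurable_of_abs_sub_le (hUL t ht))).enorm
  have hz : ∀ t, t < M.H → Measurable (z t) := fun t ht =>
    measurable_stepError hκ ht hγ (hUb (t + 1) ht) hL0 (hUL (t + 1) ht) _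
  have hzfin : ∀ t, t < M.H → l2Norm (μ t) (z t) ≠ ⊤ := fun t ht => by
    set c := clipLevel M.H Rmax (t + 1)
    have : l2Norm (μ t) (z t) ≤ ENNReal.ofReal (c + c) := by
      refine (l2Norm_mono fun x => iSup_le fun a => ?_).trans
        (l2Norm_const (μ := μ t) (ENNReal.ofReal (c + c))).le
      rw [Real.enorm_eq_ofReal_abs]
      exact ENNReal.ofReal_le_ofReal ((abs_sub _ _).trans (add_le_add
        (MDP.abs_trans_le (hUb (t + 1) ht) _ _ _) (abs_clip_le (clipLevel_nonneg hRmax ht) _)))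
    exact ne_top_of_le_ne_top ENNReal.ofReal_ne_top this
  have hmain : ∀ δ : ℝ, 0 < δ → l2Norm (μ h) (d h) ≤ max 1 (M.changeOfMeasure μ) *
      ∑ l ∈ Finset.Ico h M.H, l2Norm (μ l) (z l) + (M.H - h : ℕ) * ENNReal.ofReal δ := by
    intro δ hδ
    obtain ⟨π, hπ⟩ := exists_policy_le_stepError hκ hR hRmax hL0 hUb hUL hU hδ
    have hn : h + (M.H - h) = M.H := by omega
    have hpt : ∀ x, d h x ≤ ∑ i ∈ Finset.range (M.H - h),
        ∫⁻ y, z (h + i) y ∂(M.detKernel π h i x) + (M.H - h : ℕ) * ENNReal.ofReal δ := by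
      intro x
      have := MDP.le_sum_lintegral_detKernel π hd hπ hn.le x
      have h0 : ∫⁻ y, d (h + (M.H - h)) y ∂(M.detKernel π h (M.H - h) x) = 0 := by
        simp only [d, hn, hUH, MDP.bellman_of_not_lt (lt_irrefl _)]
        simp
      rwa [h0, add_zero] at this
    have hzm : ∀ i, i ∈ Finset.range (M.H - h) →
        Measurable fun x => ∫⁻ y, z (h + i) y ∂(M.detKernel π h i x) := fun i hi => by
      have := Finset.mem_range.1 hi
      exact (hz (h + i) (by omega)).lintegral_kernel
    calc l2Norm (μ h) (d h) ≤ l2Norm (μ h) (fun x => ∑ i ∈ Finset.range (M.H - h),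
          ∫⁻ y, z (h + i) y ∂(M.detKernel π h i x)) + (M.H - h : ℕ) * ENNReal.ofReal δ := by
          refine (l2Norm_mono hpt).trans ((l2Norm_add_le
            (Finset.measurable_fun_sum _ hzm).aemeasurable aemeasurable_const).trans ?_)
          rw [l2Norm_const]
      _ ≤ ∑ i ∈ Finset.range (M.H - h), max 1 (M.changeOfMeasure μ) *
          l2Norm (μ (h + i)) (z (h + i)) + (M.H - h : ℕ) * ENNReal.ofReal δ := by
          gcongr
          refine (l2Norm_sum_le _ fun i hi => (hzm i hi).aemeasurable).trans ?_
          refine Finset.sum_le_sum fun i hi => ?_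
          have := Finset.mem_range.1 hi
          exact MDP.l2Norm_lintegral_detKernel_le hac π (by omega) (hz _ (by omega))
            (hzfin _ (by omega))
      _ = _ := by
          rw [← Finset.mul_sum, Finset.sum_Ico_eq_sum_range]
  refine ENNReal.le_of_forall_pos_le_add fun ε hε _ => ?_
  refine (hmain (ε / ((M.H - h : ℕ) + 1)) (by positivity)).trans ?_
  gcongr
  rw [← ENNReal.ofReal_natCast, ← ENNReal.ofReal_mul (by positivity), ← ENNReal.ofReal_coe_nnreal]
  refine ENNReal.ofReal_le_ofReal ?_
  rw [mul_div_assoc', div_le_iff₀ (by positivity), mul_comm]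
  gcongr
  linarith

end OneStep

/-! ### The error of one regression step -/

section Regression

variable {S : Type u} {A : Type v} {E : Type w} {K N : ℕ}
  [MetricSpace S] [SecondCountableTopology S] [MeasurableSpace S] [OpensMeasurableSpace S]
  [MetricSpace A] [Nonempty A] [MeasurableSpace A]
  [MeasurableSpace E] {M : MDP S A} {PE : Measure E} [IsProbabilityMeasure PE]
  {κ : ℕ → S × A × E → S} {μ : ℕ → Measure S} [∀ h, IsProbabilityMeasure (μ h)]
  {γ : S → EuclideanSpace ℝ (Fin K)} {ℓ ℓ' Rmax LR LF LV Λ Lγ ϱ : ℝ}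

omit [SecondCountableTopology S] in
lemma memLp_two_of_lintegral_le {ρ : Measure S} (hγ : Continuous γ) {c : ℝ≥0∞} (hc : c ≠ ⊤)
    (h : ∫⁻ x, ‖γ x‖ₑ ^ 2 ∂ρ ≤ c) (k : Fin K) : MemLp (fun x => γ x k) 2 ρ := by
  have hk : Continuous fun x => γ x k := by fun_prop
  refine ⟨hk.measurable.aestronglyMeasurable, ?_⟩
  rw [eLpNorm_lt_top_iff_lintegral_rpow_enorm_lt_top (by norm_num) (by norm_num)]
  refine lt_of_le_of_lt ?_ (h.trans_lt hc.lt_top)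
  refine lintegral_mono fun x => ?_
  simp only [ENNReal.toReal_ofNat, ENNReal.rpow_ofNat]
  gcongr
  rw [enorm_le_iff_norm_le]
  exact PiLp.norm_apply_le (γ x) k

omit [MeasurableSpace S] [MetricSpace S] [SecondCountableTopology S] [OpensMeasurableSpace S] in
lemma enorm_linComb_sub_le (β β' : Fin K → ℝ) (x : S) :
    ‖linComb γ β x - linComb γ β' x‖ₑ ≤
      (∑ k, ‖β k - β' k‖ₑ ^ 2) ^ (1 / 2 : ℝ) * ‖γ x‖ₑ := by
  have h1 : ‖linComb γ β x - linComb γ β' x‖ₑ ≤ ∑ k, ‖β k - β' k‖ₑ * ‖γ x k‖ₑ := by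
    rw [linComb, linComb, ← Finset.sum_sub_distrib]
    refine (enorm_sum_le _ _).trans (le_of_eq ?_)
    refine Finset.sum_congr rfl fun k _ => ?_
    rw [← sub_mul, enorm_mul]
  have h2 := ENNReal.inner_le_Lp_mul_Lq Finset.univ (fun k => ‖β k - β' k‖ₑ)
    (fun k => ‖γ x k‖ₑ) Real.HolderConjugate.two_two
  have h3 : (∑ k, ‖γ x k‖ₑ ^ (2 : ℝ)) ^ (1 / 2 : ℝ) = ‖γ x‖ₑ := by
    rw [← ofReal_norm (γ x), EuclideanSpace.norm_eq, Real.sqrt_eq_rpow,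
      ← ENNReal.ofReal_rpow_of_nonneg (by positivity) (by norm_num),
      ENNReal.ofReal_sum_of_nonneg fun k _ => by positivity]
    congr 2
    funext k
    rw [ENNReal.ofReal_pow (norm_nonneg _), ofReal_norm, ENNReal.rpow_ofNat]
  rw [h3] at h2
  refine h1.trans (h2.trans (le_of_eq ?_))
  simp only [ENNReal.rpow_ofNat]

/-- The Euclidean norm of the vector of the errors of the coefficients `b`, uniformly in the
actions of the sequence `s`, compared with the least squares coefficients for the transition
operator applied to `U`. The supremum is restricted to a sequence, which will be dense, for the
sake of measurability. -/
noncomputable def coefError (M : MDP S A) (γ : S → EuclideanSpace ℝ (Fin K)) (μ : ℕ → Measure S)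
    (s : ℕ → A) (h : ℕ) (U : S → ℝ) (b : A → Fin K → ℝ) : ℝ≥0∞ :=
  (∑ k, (⨆ j, ‖b (s j) k -
    ∫ x, M.trans (h + 1) (s j) U x * dualBasis γ (μ h) x k ∂(μ h)‖ₑ) ^ 2) ^ (1 / 2 : ℝ)

omit [SecondCountableTopology S] [Nonempty A] in
/-- A regression step splits into the projection error and the error of the coefficients. -/
lemma l2Norm_stepError_le (hκ : M.LipschitzNoise PE κ ℓ ℓ')
    (hγ : FeatureBounds γ μ M.H Λ Lγ) (hϱ : 0 ≤ ϱ) {h : ℕ} (hh : h < M.H)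
    (hγ2 : ∫⁻ x, ‖γ x‖ₑ ^ 2 ∂(μ h) ≤ ENNReal.ofReal (ϱ ^ 2)) (hgram : IsUnit (gram γ (μ h)))
    {U : S → ℝ} {L : ℝ} (hL0 : 0 ≤ L) (hUb : ∀ x, |U x| ≤ clipLevel M.H Rmax (h + 1))
    (hUL : ∀ x x', |U x - U x'| ≤ L * dist x x')
    (hUζ : ∃ ζ : A → Fin K → ℝ, U = valueCoef M γ Rmax ζ (h + 1))
    {b : A → Fin K → ℝ} (hb : Continuous b) {s : ℕ → A} (hs : DenseRange s) :
    l2Norm (μ h) (stepError M γ Rmax h U b) ≤ projError M μ γ Rmax h +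
      ENNReal.ofReal ϱ * coefError M γ μ s h U b := by
  have hγc := hγ.continuous
  set c := clipLevel M.H Rmax (h + 1) with hc
  have htm : ∀ a, Continuous (M.trans (h + 1) a U) := fun a =>
    continuous_of_abs_sub_le fun x x' =>
      hκ.abs_trans_sub_state (by omega) hh hUb hL0 hUL x x' a
  have htb : ∀ a x, |M.trans (h + 1) a U x| ≤ c := fun a x => MDP.abs_trans_le hUb _ _ _
  have hta : ∀ x, Continuous fun a => M.trans (h + 1) a U x := fun x =>
    continuous_of_abs_sub_le fun a a' =>
      hκ.abs_trans_sub_action (by omega) hh hUb hL0 hUL x a a'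
  set β : A → Fin K → ℝ := fun a => regCoef γ (μ h) (M.trans (h + 1) a U) with hβ
  have hβk : ∀ a k, β a k = ∫ x, M.trans (h + 1) a U x * dualBasis γ (μ h) x k ∂(μ h) :=
    fun a k => regCoef_apply (memLp_two_of_lintegral_le hγc ENNReal.ofReal_ne_top hγ2) hgram
      (MemLp.of_bound (htm a).measurable.aestronglyMeasurable c (ae_of_all _ (htb a))) k
  set T : ℝ≥0∞ := coefError M γ μ s h U b with hT
  let p : S → ℝ≥0∞ := fun x => ⨆ j, ‖linComb γ (β (s j)) x - M.trans (h + 1) (s j) U x‖ₑ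
  have hlc : ∀ β : Fin K → ℝ, Continuous (linComb γ β) := fun β => by unfold linComb; fun_prop
  have hpm : Measurable p :=
    Measurable.iSup fun j => ((hlc _).measurable.sub (htm _).measurable).enorm
  have hpt : ∀ x, stepError M γ Rmax h U b x ≤ p x + T * ‖γ x‖ₑ := by
    intro x
    have hcont : Continuous fun a => ‖M.trans (h + 1) a U x - clip c (linComb γ (b a) x)‖ₑ :=
      ((hta x).sub ((continuous_clip c).comp ((continuous_linComb_left x).comp hb))).enorm
    rw [stepError, iSup_eq_iSup_of_denseRange hs hcont]
    refine iSup_le fun j => ?_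
    calc _ ≤ ‖M.trans (h + 1) (s j) U x - linComb γ (b (s j)) x‖ₑ := by
          -- clipping is a contraction which leaves the bounded function unchanged
          rw [enorm_le_iff_norm_le, Real.norm_eq_abs, Real.norm_eq_abs]
          have := abs_clip_sub_clip_le c (M.trans (h + 1) (s j) U x) (linComb γ (b (s j)) x)
          rwa [clip_of_abs_le (htb (s j) x)] at this
      _ = ‖-(linComb γ (β (s j)) x - M.trans (h + 1) (s j) U x) -
          (linComb γ (b (s j)) x - linComb γ (β (s j)) x)‖ₑ := by congr 1; ring
      _ ≤ ‖linComb γ (β (s j)) x - M.trans (h + 1) (s j) U x‖ₑ +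
          ‖linComb γ (b (s j)) x - linComb γ (β (s j)) x‖ₑ := by
          refine (enorm_sub_le).trans ?_
          rw [enorm_neg]
      _ ≤ _ := by
          gcongr
          · exact le_iSup (fun j => ‖linComb γ (β (s j)) x - M.trans (h + 1) (s j) U x‖ₑ) j
          · refine (enorm_linComb_sub_le _ _ x).trans ?_
            rw [hT, coefError]
            gcongr with k
            rw [hβk]
            exact le_iSup (fun j => ‖b (s j) k -
              ∫ x, M.trans (h + 1) (s j) U x * dualBasis γ (μ h) x k ∂(μ h)‖ₑ) j
  have hproj : l2Norm (μ h) p ≤ projError M μ γ Rmax h := by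
    obtain ⟨ζ, hζ⟩ := hUζ
    refine le_trans ?_ (le_iSup _ ζ)
    rw [← hζ, l2Norm, expEssSup]
    gcongr
    refine le_iInf fun g => le_iInf fun hg => le_iInf fun hdom => lintegral_mono_ae ?_
    have hall : ∀ᵐ x ∂(μ h), ∀ j, ENNReal.ofReal ((linComb γ (β (s j)) x -
        M.trans (h + 1) (s j) U x) ^ 2) ≤ g x := ae_all_iff.2 fun j => hdom (s j)
    filter_upwards [hall] with x hx
    have hle : p x ≤ g x ^ (1 / 2 : ℝ) := iSup_le fun j => by
      have h1 := hx j
      rw [← sq_abs, ENNReal.ofReal_pow (abs_nonneg _), ← Real.enorm_eq_ofReal_abs] at h1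
      calc _ = (‖linComb γ (β (s j)) x - M.trans (h + 1) (s j) U x‖ₑ ^ 2) ^ (1 / 2 : ℝ) := by
            rw [← ENNReal.rpow_natCast, ← ENNReal.rpow_mul]
            norm_num
        _ ≤ _ := by gcongr
    calc p x ^ 2 ≤ (g x ^ (1 / 2 : ℝ)) ^ 2 := by gcongr
      _ = g x := by
          rw [← ENNReal.rpow_natCast, ← ENNReal.rpow_mul]
          norm_num
  calc _ ≤ l2Norm (μ h) (fun x => p x + T * ‖γ x‖ₑ) := l2Norm_mono hpt
    _ ≤ l2Norm (μ h) p + l2Norm (μ h) (fun x => T * ‖γ x‖ₑ) :=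
        l2Norm_add_le hpm.aemeasurable (hγc.enorm.measurable.const_mul T).aemeasurable
    _ ≤ _ := by
        gcongr
        rw [l2Norm_const_mul _ hγc.enorm.measurable.aemeasurable, mul_comm]
        gcongr
        rw [l2Norm_le_iff, ← ENNReal.ofReal_pow hϱ]
        exact hγ2

/-! ### Averaging over the data -/

/-- Tonelli's theorem for one coordinate of a product probability measure. -/
lemma lintegral_pi_eq_lintegral_update {ι : Type*} [Fintype ι] [DecidableEq ι] {X : ι → Type*}
    [∀ i, MeasurableSpace (X i)] (ν : ∀ i, Measure (X i)) [∀ i, IsProbabilityMeasure (ν i)]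
    (i : ι) {f : (∀ i, X i) → ℝ≥0∞} (hf : Measurable f) :
    ∫⁻ x, f x ∂(Measure.pi ν) =
      ∫⁻ x, ∫⁻ y, f (Function.update x i y) ∂(ν i) ∂(Measure.pi ν) := by
  have hg : (fun x => ∫⁻ y, f (Function.update x i y) ∂(ν i)) = lmarginal ν {i} f :=
    (lmarginal_singleton f i).symm
  refine lintegral_eq_of_lmarginal_eq {i} hf (by rw [hg]; exact hf.lmarginal ν) ?_
  rw [lmarginal_singleton, lmarginal_singleton]
  simp

omit [Nonempty A] in
lemma measurable_iSup_coefError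
    (hκ : M.LipschitzNoise PE κ ℓ ℓ') (hγ : FeatureBounds γ μ M.H Λ Lγ) {l : ℕ} (hl : l < M.H)
    {V : (Fin M.H → Fin N → S × E) → S → ℝ} (hVm : Measurable (Function.uncurry V)) (s : ℕ → A)
    (k : Fin K) :
    Measurable fun data : Fin M.H → Fin N → S × E => ⨆ j,
      ‖betaHat γ (μ l) (κ (l + 1)) (V data) (data ⟨l, hl⟩) (s j) k -
        ∫ x, M.trans (l + 1) (s j) (V data) x * dualBasis γ (μ l) x k ∂(μ l)‖ₑ := by
  have hκm := hκ.measurable (l + 1) (by omega) hl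
  have htr : ∀ data a x, M.trans (l + 1) a (V data) x = ∫ ε, V data (κ (l + 1) (x, a, ε)) ∂PE :=
    fun data a x => hκ.trans_eq (by omega) hl (hVm.comp measurable_prodMk_left) a x
  refine Measurable.iSup fun j => (Measurable.sub ?_ ?_).enorm
  · exact measurable_betaHat hκ hγ hl hVm (s j) k
  · simp only [htr]
    have h1 : Measurable fun q : ((Fin M.H → Fin N → S × E) × S) × E =>
        V q.1.1 (κ (l + 1) (q.1.2, s j, q.2)) :=
      hVm.comp (measurable_fst.fst.prodMk (hκm.comp (by fun_prop)))
    have h2 : Measurable fun q : (Fin M.H → Fin N → S × E) × S =>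
        (∫ ε, V q.1 (κ (l + 1) (q.2, s j, ε)) ∂PE) * dualBasis γ (μ l) q.2 k :=
      (h1.stronglyMeasurable.integral_prod_right' (ν := PE)).measurable.mul
        ((hγ.measurable_dualBasis l k).comp measurable_snd)
    exact (h2.stronglyMeasurable.integral_prod_right' (ν := μ l)).measurable

omit [Nonempty A] in
lemma measurable_coefError
    (hκ : M.LipschitzNoise PE κ ℓ ℓ') (hγ : FeatureBounds γ μ M.H Λ Lγ) {l : ℕ} (hl : l < M.H)
    {V : (Fin M.H → Fin N → S × E) → S → ℝ} (hVm : Measurable (Function.uncurry V)) (s : ℕ → A) :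
    Measurable fun data : Fin M.H → Fin N → S × E => coefError M γ μ s l (V data)
      (betaHat γ (μ l) (κ (l + 1)) (V data) (data ⟨l, hl⟩)) :=
  (Finset.measurable_fun_sum _ fun k _ =>
    (measurable_iSup_coefError hκ hγ hl hVm s k).pow_const 2).pow_const _

/-- The error of the regression coefficients at time `l`, averaged over the data. Given the data
from time `l + 1` on, the regressed function is fixed and the bound for a fixed function
applies. -/
lemma l2Norm_coefError_le [SecondCountableTopology A] (hA : TotallyBounded (Set.univ : Set A))
    (hκ : M.LipschitzNoise PE κ ℓ ℓ') (hℓ' : 0 ≤ ℓ') (hR : M.LipschitzReward Rmax LR LV)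
    (hRmax : 0 ≤ Rmax) (hγ : FeatureBounds γ μ M.H Λ Lγ) (hΛ : 0 ≤ Λ) (hN : 0 < N)
    (hLV0 : 0 ≤ LV) (hLV : LV = LR + (M.H + 1) * Rmax * Λ * Lγ * Real.sqrt K)
    {l : ℕ} (hl : l < M.H) (s : ℕ → A) :
    l2Norm (dataLaw M.H N μ PE) (fun data => coefError M γ μ s l
      (valueEst M κ μ γ Rmax data (l + 1)) (betaHat γ (μ l) (κ (l + 1))
        (valueEst M κ μ γ Rmax data (l + 1)) (data ⟨l, hl⟩))) ≤
    ENNReal.ofReal (Real.sqrt K * (Λ / Real.sqrt N)) * (ENNReal.ofReal (LV * ℓ') *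
      (6 * dudleyIntegral A + 4 * Metric.ediam (Set.univ : Set A)) +
        2 * ENNReal.ofReal ((M.H + 1) * Rmax)) := by
  set V : (Fin M.H → Fin N → S × E) → S → ℝ :=
    fun data => valueEst M κ μ γ Rmax data (l + 1) with hV
  have hVm : Measurable (Function.uncurry V) :=
    measurable_valueEst hκ hℓ' hR hRmax hγ hΛ hN hLV0 hLV hl
  have hVb : ∀ data x, |V data x| ≤ (M.H + 1) * Rmax := fun data x =>
    (hR.abs_valueEst_le hRmax data hl x).trans (clipLevel_le hRmax _)
  have hVL : ∀ data x x', |V data x - V data x'| ≤ LV * dist x x' := fun data =>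
    hR.lipschitz_valueEst hRmax hγ hΛ hN hLV data hl
  have hκm := hκ.measurable (l + 1) (by omega) hl
  let e : Fin K → (Fin M.H → Fin N → S × E) → ℝ≥0∞ := fun k data => ⨆ j,
    ‖betaHat γ (μ l) (κ (l + 1)) (V data) (data ⟨l, hl⟩) (s j) k -
      ∫ x, M.trans (l + 1) (s j) (V data) x * dualBasis γ (μ l) x k ∂(μ l)‖ₑ
  have htr : ∀ data a x, M.trans (l + 1) a (V data) x = ∫ ε, V data (κ (l + 1) (x, a, ε)) ∂PE :=
    fun data a x => hκ.trans_eq (by omega) hl (measurable_of_abs_sub_le (hVL data)) a x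
  have hem : ∀ k, Measurable (e k) := measurable_iSup_coefError hκ hγ hl hVm s
  set Bd : ℝ≥0∞ := ENNReal.ofReal (Λ / Real.sqrt N) * (ENNReal.ofReal (LV * ℓ') *
      (6 * dudleyIntegral A + 4 * Metric.ediam (Set.univ : Set A)) +
        2 * ENNReal.ofReal ((M.H + 1) * Rmax)) with hBd
  have hek : ∀ k, ∫⁻ data, e k data ^ 2 ∂(dataLaw M.H N μ PE) ≤ Bd ^ 2 := by
    intro k
    unfold dataLaw
    rw [lintegral_pi_eq_lintegral_update _ ⟨l, hl⟩ ((hem k).pow_const 2)]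
    calc _ ≤ ∫⁻ _data, Bd ^ 2 ∂(Measure.pi fun t : Fin M.H =>
          Measure.pi fun _ : Fin N => (μ t).prod PE) := by
          refine lintegral_mono fun data => ?_
          rw [← l2Norm_le_iff]
          have hupd : ∀ y, V (Function.update data ⟨l, hl⟩ y) = V data := fun y =>
            valueEst_congr hl fun t ht => Function.update_of_ne
              (fun h => by rw [h] at ht; exact absurd ht (by simp)) _ _
          refine le_trans (l2Norm_mono fun y => iSup_le fun j => ?_)
            (l2Norm_iSup_betaHat_sub_le (κ := κ (l + 1)) (V := V data) hA hN
              (hγ.norm_dualBasis_le l hl) hΛ (hVb data) (L := LV * ℓ') (by positivity)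
              (fun x ε a a' => ?_) (fun a => ?_) k (hγ.measurable_dualBasis l k))
          · rw [hupd, Function.update_self]
            simp only [htr]
            exact le_iSup (fun a => ‖betaHat γ (μ l) (κ (l + 1)) (V data) y a k -
              ∫ x, (∫ ε, V data (κ (l + 1) (x, a, ε)) ∂PE) * dualBasis γ (μ l) x k ∂(μ l)‖ₑ) (s j)
          · refine (hVL data _ _).trans ?_
            rw [mul_assoc]
            exact mul_le_mul_of_nonneg_left (hκ.dist_action (l + 1) (by omega) hl x a a' ε) hLV0
          · exact (measurable_of_abs_sub_le (hVL data)).comp (hκm.comp (by fun_prop))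
      _ = Bd ^ 2 := by simp
  clear_value Bd
  rw [l2Norm_le_iff]
  calc _ = ∫⁻ data, ∑ k, e k data ^ 2 ∂(dataLaw M.H N μ PE) := by
        refine lintegral_congr fun data => ?_
        rw [coefError, ← ENNReal.rpow_natCast, ← ENNReal.rpow_mul]
        norm_num
        rfl
    _ = ∑ k, ∫⁻ data, e k data ^ 2 ∂(dataLaw M.H N μ PE) :=
        lintegral_finsetSum _ fun k _ => (hem k).pow_const 2
    _ ≤ ∑ _k : Fin K, Bd ^ 2 := Finset.sum_le_sum fun k _ => hek k
    _ = K * Bd ^ 2 := by simp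
    _ = (ENNReal.ofReal (Real.sqrt K) * Bd) ^ 2 := by
        rw [mul_pow, ← ENNReal.ofReal_pow (by positivity), Real.sq_sqrt (by positivity),
          ENNReal.ofReal_natCast]
    _ = _ := by rw [ENNReal.ofReal_mul (by positivity), mul_assoc, ← hBd]

end Regression

instance isProbabilityMeasure_dataLaw {S : Type u} {E : Type w} [MeasurableSpace S]
    [MeasurableSpace E] (H N : ℕ) (μ : ℕ → Measure S) [∀ h, IsProbabilityMeasure (μ h)]
    (PE : Measure E) [IsProbabilityMeasure PE] : IsProbabilityMeasure (dataLaw H N μ PE) := by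
  unfold dataLaw
  infer_instance

theorem mainTheorem1 :
    ∃ C : ℝ, 0 < C ∧
      ∀ (S : Type u) (A : Type v) (E : Type w)
        [MetricSpace S] [SecondCountableTopology S] [MeasurableSpace S] [OpensMeasurableSpace S]
        [MetricSpace A] [MeasurableSpace A] [Nonempty A] [MeasurableSpace E]
        (_ : TotallyBounded (Set.univ : Set A))
        (M : MDP S A)
        -- random iterative functions driven by noise with law `PE`
        (PE : Measure E) [IsProbabilityMeasure PE]
        (κ : ℕ → S × A × E → S)
        (_ : ∀ h, 1 ≤ h → h ≤ M.H → Measurable (κ h))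
        (_ : ∀ h, 1 ≤ h → h ≤ M.H → ∀ (x : S) (a : A),
          M.P h (x, a) = PE.map (fun e => κ h (x, a, e)))
        -- Lipschitz dynamics, with respect to a norm `ν` on the plane
        (ν : Seminorm ℝ (ℝ × ℝ)) (_ : ∀ z, ν z = 0 → z = 0)
        (Lκ : ℝ) (_ : 0 ≤ Lκ)
        (_ : ∀ h, 1 ≤ h → h ≤ M.H → ∀ (x x' : S) (a a' : A) (e : E),
          dist (κ h (x, a, e)) (κ h (x', a', e)) ≤ Lκ * ν (dist x x', dist a a'))
        -- bounded Lipschitz rewards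
        (Rmax LR : ℝ) (_ : 0 ≤ LR)
        (_ : ∀ h, h < M.H → ∀ (x : S) (a : A), |M.R h (x, a)| ≤ Rmax)
        (_ : ∀ x, |M.F x| ≤ Rmax)
        (_ : ∀ h, h < M.H → ∀ (x x' : S) (a : A),
          |M.R h (x, a) - M.R h (x', a)| ≤ LR * dist x x')
        -- reference measures
        (μ : ℕ → Measure S) (_ : ∀ h, IsProbabilityMeasure (μ h))
        (_ : ∀ h, 1 ≤ h → h ≤ M.H → ∀ (x : S) (a : A), M.P h (x, a) ≪ μ h)
        (_ : M.changeOfMeasure μ < ⊤)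
        -- basis functions
        (K : ℕ) (γ : S → EuclideanSpace ℝ (Fin K)) (Λ Lγ ϱ : ℝ) (_ : 0 ≤ Lγ) (_ : 0 ≤ ϱ)
        (_ : ∀ x x' : S, ‖γ x - γ x'‖ ≤ Lγ * dist x x')
        (_ : ∀ h, h < M.H → ∫⁻ x, ‖γ x‖ₑ ^ 2 ∂(μ h) ≤ ENNReal.ofReal (ϱ ^ 2))
        (_ : ∀ h, h < M.H → IsUnit (gram γ (μ h)))
        (_ : ∀ h, h < M.H → ∀ x : S, ‖dualBasis γ (μ h) x‖ ≤ Λ)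
        -- the Lipschitz constant of the estimates, and the Lipschitz terminal reward
        (Vmax LV : ℝ) (_ : Vmax = ((M.H : ℝ) + 1) * Rmax)
        (_ : LV = LR + Vmax * Λ * Lγ * Real.sqrt (K : ℝ))
        (_ : ∀ x x' : S, |M.F x - M.F x'| ≤ LV * dist x x')
        -- sample size and time
        (N : ℕ) (_ : 0 < N) (h : ℕ) (_ : h ≤ M.H),
        AEStronglyMeasurable
          (fun p : S × (Fin M.H → Fin N → S × E) =>
            M.optValue h p.1 - valueEst M κ μ γ Rmax p.2 h p.1)
          ((μ h).prod (dataLaw M.H N μ PE)) ∧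
        eLpNorm
          (fun p : S × (Fin M.H → Fin N → S × E) =>
            M.optValue h p.1 - valueEst M κ μ γ Rmax p.2 h p.1)
          2 ((μ h).prod (dataLaw M.H N μ PE))
        ≤ ENNReal.ofReal (C * max 1 (ν (0, 1))) * max 1 (M.changeOfMeasure μ) *
          (ENNReal.ofReal (((M.H : ℝ) - h) * ϱ * Λ * Real.sqrt ((K : ℝ) / N)) *
              (ENNReal.ofReal (LV * Lκ) * dudleyIntegral A
                + ENNReal.ofReal (LV * Lκ) * Metric.ediam (Set.univ : Set A)
                + ENNReal.ofReal Vmax)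
            + ∑ l ∈ Finset.Ico h M.H, projError M μ γ Rmax l) := by 
  refine ⟨6, by norm_num, ?_⟩
  intro S A E _ _ _ _ _ _ _ _ hA M PE _ κ hκm hκlaw ν hν Lκ hLκ hκdist Rmax LR hLR hRb hFb hRlip μ
    hμ hac _ K γ Λ Lγ ϱ hLγ hϱ hγlip hγ2 hgram hdual Vmax LV hVmax hLV hF N hN h hh
  have hscale : ∀ (d : ℝ) (z : ℝ × ℝ), 0 ≤ d → ν (d • z) = ν z * d := fun d z hd => by
    rw [map_smul_eq_mul, Real.norm_of_nonneg hd, mul_comm]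
  have hκ : M.LipschitzNoise PE κ (Lκ * ν (1, 0)) (Lκ * ν (0, 1)) :=
    { measurable := hκm
      law := hκlaw
      dist_state := fun h h1 hH x x' a e => by
        have := hκdist h h1 hH x x' a a e
        rwa [dist_self, show (dist x x', (0 : ℝ)) = dist x x' • ((1, 0) : ℝ × ℝ) by simp,
          hscale _ _ dist_nonneg, ← mul_assoc] at this
      dist_action := fun h h1 hH x a a' e => by
        have := hκdist h h1 hH x x a a' e
        rwa [dist_self, show ((0 : ℝ), dist a a') = dist a a' • ((0, 1) : ℝ × ℝ) by simp,
          hscale _ _ dist_nonneg, ← mul_assoc] at this }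
  have hR : M.LipschitzReward Rmax LR LV := ⟨hRb, hFb, hRlip, hF⟩
  rw [hR.optValue_eq_bellman hκ hh]
  -- at the horizon there is no error; before it, `hdual` shows that `Λ` is nonnegative
  rcases hh.eq_or_lt with rfl | hlt
  · simp [MDP.bellman_of_not_lt (lt_irrefl _), valueEst_of_not_lt (lt_irrefl _),
      aestronglyMeasurable_const]
  obtain ⟨x₀⟩ : Nonempty S := nonempty_of_isProbabilityMeasure (μ 0)
  have hRmax : 0 ≤ Rmax := (abs_nonneg _).trans (hFb x₀)
  have hΛ : 0 ≤ Λ := (norm_nonneg _).trans (hdual h hlt x₀)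
  have hν0 : 0 ≤ ν (0, 1) := apply_nonneg _ _
  have hℓ' : 0 ≤ Lκ * ν (0, 1) := by positivity
  have hVmax0 : 0 ≤ Vmax := by rw [hVmax]; positivity
  have hLV0 : 0 ≤ LV := by rw [hLV]; positivity
  have hγ : FeatureBounds γ μ M.H Λ Lγ := ⟨hγlip, hdual⟩
  rw [hVmax] at hLV
  have : TopologicalSpace.SeparableSpace A :=
    TopologicalSpace.isSeparable_univ_iff.1 hA.isSeparable
  have : SecondCountableTopology A := UniformSpace.secondCountable_of_separable A
  have hest : Measurable (Function.uncurry fun (data : Fin M.H → Fin N → S × E) x =>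
      valueEst M κ μ γ Rmax data h x) :=
    measurable_valueEst hκ hℓ' hR hRmax hγ hΛ hN hLV0 hLV hh
  have hbell : Measurable (M.bellman h) := by
    obtain ⟨L, -, hL⟩ := hR.exists_lipschitz_bellman hκ hh
    exact measurable_of_abs_sub_le hL
  have hmeas : Measurable fun p : S × (Fin M.H → Fin N → S × E) =>
      M.bellman h p.1 - valueEst M κ μ γ Rmax p.2 h p.1 :=
    (hbell.comp measurable_fst).sub (hest.comp measurable_swap)
  refine ⟨hmeas.aestronglyMeasurable, ?_⟩
  let s := TopologicalSpace.denseSeq A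
  have hs : DenseRange s := TopologicalSpace.denseRange_denseSeq A
  let U : (Fin M.H → Fin N → S × E) → ℕ → S → ℝ := fun data t => valueEst M κ μ γ Rmax data t
  have hUb : ∀ data t, t ≤ M.H → ∀ x, |U data t x| ≤ clipLevel M.H Rmax t :=
    fun data t ht x => hR.abs_valueEst_le hRmax data ht x
  have hUL : ∀ data t, t ≤ M.H → ∀ x x', |U data t x - U data t x'| ≤ LV * dist x x' :=
    fun data t ht x x' => hR.lipschitz_valueEst hRmax hγ hΛ hN hLV data ht x x'
  let b : (Fin M.H → Fin N → S × E) → (t : ℕ) → A → Fin K → ℝ := fun data t =>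
    if ht : t < M.H then betaHat γ (μ t) (κ (t + 1)) (U data (t + 1)) (data ⟨t, ht⟩) else 0
  have hb : ∀ data t (ht : t < M.H),
      b data t = betaHat γ (μ t) (κ (t + 1)) (U data (t + 1)) (data ⟨t, ht⟩) :=
    fun data t ht => dif_pos ht
  have hbc : ∀ data t, t < M.H → Continuous (b data t) := fun data t ht => by
    rw [hb data t ht]
    refine continuous_betaHat hN (hγ.norm_dualBasis_le t ht) (L := LV * (Lκ * ν (0, 1)))
      (by positivity) (fun x e a a' => ?_) _
    refine (hUL data (t + 1) ht _ _).trans ?_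
    rw [mul_assoc]
    exact mul_le_mul_of_nonneg_left (hκ.dist_action (t + 1) (by omega) ht x a a' e) hLV0
  let T : ℕ → (Fin M.H → Fin N → S × E) → ℝ≥0∞ := fun l data =>
    coefError M γ μ s l (U data (l + 1)) (b data l)
  have hTm : ∀ l, l < M.H → Measurable (T l) := fun l hl => by
    simp only [T, hb _ l hl]
    exact measurable_coefError hκ hγ hl
      (measurable_valueEst hκ hℓ' hR hRmax hγ hΛ hN hLV0 hLV hl) s
  set ρ : ℝ≥0∞ := max 1 (M.changeOfMeasure μ) with hρ
  set Bd : ℝ≥0∞ := ENNReal.ofReal (Real.sqrt K * (Λ / Real.sqrt N)) *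
    (ENNReal.ofReal (LV * (Lκ * ν (0, 1))) *
      (6 * dudleyIntegral A + 4 * Metric.ediam (Set.univ : Set A)) +
        2 * ENNReal.ofReal ((M.H + 1) * Rmax)) with hBd
  have hTB : ∀ l, l < M.H → l2Norm (dataLaw M.H N μ PE) (T l) ≤ Bd := fun l hl => by
    simp only [T, hb _ l hl]
    exact l2Norm_coefError_le hA hκ hℓ' hR hRmax hγ hΛ hN hLV0 hLV hl s
  have hdata : ∀ data, l2Norm (μ h) (fun x => ‖M.bellman h x - U data h x‖ₑ) ≤
      ρ * ∑ l ∈ Finset.Ico h M.H, (projError M μ γ Rmax l + ENNReal.ofReal ϱ * T l data) := by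
    intro data
    refine (l2Norm_bellman_sub_le_sum_stepError hκ hR hRmax hγ.continuous hac hLV0 (hUb data)
      (hUL data) (b := b data) (fun t ht x => ?_) (valueEst_of_not_lt (lt_irrefl _)) hh).trans ?_
    · simp only [U, valueEst_of_lt ht, hb data t ht]
    · gcongr with l hl
      have hl' := (Finset.mem_Ico.1 hl).2
      exact l2Norm_stepError_le hκ hγ hϱ hl' (hγ2 l hl') (hgram l hl') hLV0
        (hUb data (l + 1) hl') (hUL data (l + 1) hl') (exists_valueEst_eq_valueCoef data (l + 1))
        (hbc data l hl') hs
  have hprod : eLpNorm (fun p : S × (Fin M.H → Fin N → S × E) =>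
      M.bellman h p.1 - valueEst M κ μ γ Rmax p.2 h p.1) 2
        ((μ h).prod (dataLaw M.H N μ PE)) =
      l2Norm (dataLaw M.H N μ PE) fun data =>
        l2Norm (μ h) fun x => ‖M.bellman h x - U data h x‖ₑ := by
    rw [eLpNorm_eq_lintegral_rpow_enorm_toReal (by norm_num) (by norm_num), l2Norm]
    simp only [sq_l2Norm, ENNReal.toReal_ofNat, ENNReal.rpow_ofNat]
    rw [lintegral_prod_symm' _ (hmeas.enorm.pow_const 2)]
  rw [hprod]
  have hsum : l2Norm (dataLaw M.H N μ PE) (fun data =>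
      l2Norm (μ h) fun x => ‖M.bellman h x - U data h x‖ₑ) ≤
      ρ * ∑ l ∈ Finset.Ico h M.H, (projError M μ γ Rmax l + ENNReal.ofReal ϱ * Bd) := by
    have hm : ∀ l ∈ Finset.Ico h M.H, Measurable fun data =>
        projError M μ γ Rmax l + ENNReal.ofReal ϱ * T l data := fun l hl =>
      ((hTm l (Finset.mem_Ico.1 hl).2).const_mul _).const_add _
    refine (l2Norm_mono hdata).trans ?_
    rw [l2Norm_const_mul _ (Finset.measurable_fun_sum _ hm).aemeasurable]
    gcongr
    refine (l2Norm_sum_le _ fun l hl => (hm l hl).aemeasurable).trans ?_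
    gcongr with l hl
    have hl' := (Finset.mem_Ico.1 hl).2
    refine (l2Norm_add_le aemeasurable_const ((hTm l hl').const_mul _).aemeasurable).trans ?_
    rw [l2Norm_const, l2Norm_const_mul _ (hTm l hl').aemeasurable]
    gcongr
    exact hTB l hl'
  refine hsum.trans ?_
  set m : ℝ := max 1 (ν (0, 1)) with hm
  have hm1 : 1 ≤ m := le_max_left _ _
  set I := dudleyIntegral A
  set D := Metric.ediam (Set.univ : Set A)
  have hinner : ENNReal.ofReal (LV * (Lκ * ν (0, 1))) * (6 * I + 4 * D) +
      2 * ENNReal.ofReal ((M.H + 1) * Rmax) ≤ ENNReal.ofReal (6 * m) *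
        (ENNReal.ofReal (LV * Lκ) * I + ENNReal.ofReal (LV * Lκ) * D + ENNReal.ofReal Vmax) := by
    rw [← hVmax, ENNReal.ofReal_mul (by norm_num : (0 : ℝ) ≤ 6), ← mul_assoc LV,
      ENNReal.ofReal_mul (by positivity)]
    have h6 : ENNReal.ofReal 6 = 6 := by simp
    have hνm : ENNReal.ofReal (ν (0, 1)) ≤ ENNReal.ofReal m :=
      ENNReal.ofReal_le_ofReal (le_max_right _ _)
    have h1m : 1 ≤ ENNReal.ofReal m := by simpa using ENNReal.ofReal_le_ofReal hm1
    rw [h6]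
    calc _ ≤ ENNReal.ofReal (LV * Lκ) * ENNReal.ofReal m * (6 * I + 6 * D) +
          6 * (ENNReal.ofReal m * ENNReal.ofReal Vmax) := by
          gcongr
          · norm_num
          · norm_num
          · exact le_mul_of_one_le_left zero_le h1m
      _ = _ := by ring
  have hBd' : ∑ _l ∈ Finset.Ico h M.H, ENNReal.ofReal ϱ * Bd ≤ ENNReal.ofReal (6 * m) *
      (ENNReal.ofReal (((M.H : ℝ) - h) * ϱ * Λ * Real.sqrt ((K : ℝ) / N)) *
        (ENNReal.ofReal (LV * Lκ) * I + ENNReal.ofReal (LV * Lκ) * D + ENNReal.ofReal Vmax)) := by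
    have hcoef : ENNReal.ofReal (((M.H : ℝ) - h) * ϱ * Λ * Real.sqrt ((K : ℝ) / N)) =
        ((M.H - h : ℕ) : ℝ≥0∞) * (ENNReal.ofReal ϱ *
          ENNReal.ofReal (Real.sqrt K * (Λ / Real.sqrt N))) := by
      rw [← ENNReal.ofReal_mul hϱ, ← ENNReal.ofReal_natCast,
        ← ENNReal.ofReal_mul (by positivity), Nat.cast_sub hh, Real.sqrt_div (by positivity)]
      congr 1
      ring
    rw [Finset.sum_const, Nat.card_Ico, nsmul_eq_mul, hcoef, hBd]
    calc _ ≤ ((M.H - h : ℕ) : ℝ≥0∞) * (ENNReal.ofReal ϱ *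
          (ENNReal.ofReal (Real.sqrt K * (Λ / Real.sqrt N)) * (ENNReal.ofReal (6 * m) *
          (ENNReal.ofReal (LV * Lκ) * I + ENNReal.ofReal (LV * Lκ) * D +
            ENNReal.ofReal Vmax)))) := by gcongr
      _ = _ := by ring
  have hC1 : 1 ≤ ENNReal.ofReal (6 * m) := by
    simpa using ENNReal.ofReal_le_ofReal (show (1 : ℝ) ≤ 6 * m by linarith)
  rw [Finset.sum_add_distrib, mul_comm (ENNReal.ofReal (6 * m)) ρ, mul_assoc ρ, add_comm,
    mul_add (ENNReal.ofReal (6 * m))]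
  gcongr
  exact le_mul_of_one_le_left zero_le hC1
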